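/- Let $d\ge 1$ and $q\ge 1$ be integers, let $N\in\mathbb N$, and let $u_1,\dots,u_N\in H^1(\mathbb R^d,\mathbb C^q)$ be orthonormal in $L^2(\mathbb R^d,\mathbb C^q)$. Let $R(x)=\sum_{n=1}^N u_n(x)u_n(x)^*$, a Hermitian nonnegative $q\times q$ matrix for a.e. $x\in\mathbb R^d$. Then $\operatorname{Tr}_{\mathbb C^q}\big(R^{1+2/d}\big)$ is integrable on $\mathbb R^d$ and $$\sum_{n=1}^N\int_{\mathbb R^d}|\nabla u_n(x)|^2_{\mathbb C^q}\,dx\ \ge\ \tilde K_d\int_{\mathbb R^d}\operatorname{Tr}_{\mathbb C^q}\big(R(x)^{1+2/d}\big)\,dx ,$$ where $|\nabla u_n|^2_{\mathbb C^q}=\sum_{i=1}^d|\partial_i u_n|^2_{\mathbb C^q}$, $$\tilde K_d=\frac{2^{6/d}\,d^2\,(2\pi)^2}{(d+2)^{2+4/d}\,|\mathbb S^{d-1}|^{2/d}}\ \mathcal I_d^{-2/d}=\frac{2^{6/d}\,d^{1-2/d}}{(d+2)^{1+4/d}}\ \mathcal I_d^{-2/d}\,K_d^{\mathrm{cl}},\qquad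 K_d^{\mathrm{cl}}=\frac{d}{d+2}\,\frac{(2\pi)^2}{\omega_d^{2/d}},$$ $|\mathbb S^{d-1}|$ and $\omega_d$ are the surface measure of the unit sphere and the volume of the unit ball in $\mathbb R^d$, and $\mathcal I_d\in(0,\infty)$ is defined by $$\mathcal I_d=\inf\left\{\Big(\int_0^\infty w(s)^2\,ds\Big)^{d/2}\int_0^\infty\frac{(1-g(t))^2}{t^{1+d/2}}\,dt\right\},\qquad g(t)=\int_0^\infty w(s)f(st)\,ds ,$$ the infimum being taken over all nonnegative functions $f,w\in L^2(0,\infty)$ with $\int_0^\infty f(s)^2\,ds=1$ for which $\int_0^\infty (1-g(t))^2\,t^{-1-d/2}\,dt$ is finite. In particular, $0<\mathcal I_d<\infty$. -/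

import Mathlib

open MeasureTheory TemperedDistribution Set
open scoped SchwartzMap LineDeriv

noncomputable section

namespace MatrixKinetic

/-- The Hilbert space `L²(ℝ^d, ℂ^q)`. -/
abbrev L2 (d q : ℕ) : Type :=
  Lp (EuclideanSpace ℂ (Fin q)) 2 (volume : Measure (EuclideanSpace ℝ (Fin d)))

/-- `u ∈ H¹(ℝ^d, ℂ^q)`: the tempered distribution given by `u` lies in the Sobolev space of order
`1` based on `L²`. -/
def MemH1 {d q : ℕ} (u : L2 d q) : Prop :=
  MemSobolev 1 2 (u : 𝓢'(EuclideanSpace ℝ (Fin d), EuclideanSpace ℂ (Fin q)))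

/-- The distributional partial derivatives of an `H¹` function are `L²` functions. -/
theorem MemH1.exists_partialDeriv {d q : ℕ} {u : L2 d q} (hu : MemH1 u) (i : Fin d) :
    ∃ v : L2 d q,
      (∂_{EuclideanSpace.single i (1 : ℝ)}
        (u : 𝓢'(EuclideanSpace ℝ (Fin d), EuclideanSpace ℂ (Fin q)))) = v := by
  have h := MemSobolev.lineDerivOp hu (m := EuclideanSpace.single i (1 : ℝ))
  rw [sub_self] at h
  exact memSobolev_zero_iff.mp h

/-- The weak partial derivative `∂_i u ∈ L²(ℝ^d, ℂ^q)` of `u ∈ H¹(ℝ^d, ℂ^q)`. -/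
def weakPartial {d q : ℕ} {u : L2 d q} (hu : MemH1 u) (i : Fin d) : L2 d q :=
  (hu.exists_partialDeriv i).choose

/-- The defining property of `weakPartial`. -/
theorem weakPartial_spec {d q : ℕ} {u : L2 d q} (hu : MemH1 u) (i : Fin d) :
    (∂_{EuclideanSpace.single i (1 : ℝ)}
      (u : 𝓢'(EuclideanSpace ℝ (Fin d), EuclideanSpace ℂ (Fin q)))) = weakPartial hu i :=
  (hu.exists_partialDeriv i).choose_spec

/-- `∫ |∇u(x)|² dx`, where `|∇u(x)|² = ∑ᵢ |∂ᵢu(x)|²`. -/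
def gradSqIntegral {d q : ℕ} {u : L2 d q} (hu : MemH1 u) : ℝ :=
  ∫ x, ∑ i : Fin d, ‖weakPartial hu i x‖ ^ 2

/-- The Hermitian nonnegative `q × q` matrix `R(x) = ∑ₙ uₙ(x) uₙ(x)^*`. -/
def densityMatrix {d q N : ℕ} (u : Fin N → L2 d q) (x : EuclideanSpace ℝ (Fin d)) :
    Matrix (Fin q) (Fin q) ℂ :=
  ∑ n, Matrix.vecMulVec (⇑(u n x)) (star (⇑(u n x)))

/-- `Tr_{ℂ^q} (A ^ p)` for a Hermitian nonnegative matrix `A`; the power is taken in the continuous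
functional calculus, and the (real) trace is read as a real number. -/
def tracePow {q : ℕ} (A : Matrix (Fin q) (Fin q) ℂ) (p : ℝ) : ℝ :=
  (Matrix.trace (cfc (fun t : ℝ => t ^ p) A)).re

/-- `g(t) = ∫₀^∞ w(s) f(s t) ds`. -/
def gFun (f w : ℝ → ℝ) (t : ℝ) : ℝ := ∫ s in Ioi (0 : ℝ), w s * f (s * t)

/-- `∫₀^∞ (1 - g(t))² / t^{1 + d/2} dt`. -/
def gDefect (d : ℕ) (f w : ℝ → ℝ) : ℝ :=
  ∫ t in Ioi (0 : ℝ), (1 - gFun f w t) ^ 2 / t ^ (1 + (d : ℝ) / 2)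

/-- The competitors in the variational problem: nonnegative square-integrable functions `f, w` on
`(0, ∞)` with `∫ f² = 1`, for which `∫₀^∞ (1 - g(t))² / t^{1 + d/2} dt` is finite.
(A pair for which that integral is infinite has the value `+∞`.) -/
structure Admissible (d : ℕ) (f w : ℝ → ℝ) : Prop where
  f_nonneg : ∀ s ∈ Ioi (0 : ℝ), 0 ≤ f s
  w_nonneg : ∀ s ∈ Ioi (0 : ℝ), 0 ≤ w s
  f_memLp : MemLp f 2 (volume.restrict (Ioi (0 : ℝ)))
  w_memLp : MemLp w 2 (volume.restrict (Ioi (0 : ℝ)))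
  f_norm : ∫ s in Ioi (0 : ℝ), f s ^ 2 = 1
  defect_finite :
    IntegrableOn (fun t : ℝ => (1 - gFun f w t) ^ 2 / t ^ (1 + (d : ℝ) / 2)) (Ioi (0 : ℝ))

/-- The variational quantity `𝓘_d`. -/
def varI (d : ℕ) : ℝ :=
  sInf {c : ℝ | ∃ f w : ℝ → ℝ, Admissible d f w ∧
    c = (∫ s in Ioi (0 : ℝ), w s ^ 2) ^ ((d : ℝ) / 2) * gDefect d f w}

/-- The surface measure `|𝕊^{d-1}|` of the unit sphere of `ℝ^d`. -/
def sphereArea (d : ℕ) : ℝ :=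
  (volume : Measure (EuclideanSpace ℝ (Fin d))).toSphere.real univ

/-- The volume `ω_d` of the unit ball of `ℝ^d`. -/
def ballVolume (d : ℕ) : ℝ :=
  (volume : Measure (EuclideanSpace ℝ (Fin d))).real (Metric.ball 0 1)

/-- The semiclassical constant `K_d^cl = d/(d+2) · (2π)² / ω_d^{2/d}`. -/
def Kcl (d : ℕ) : ℝ :=
  (d : ℝ) / (d + 2) * ((2 * Real.pi) ^ 2 / ballVolume d ^ (2 / (d : ℝ)))

/-- The constant
`K̃_d = 2^{6/d} d² (2π)² / ((d+2)^{2+4/d} |𝕊^{d-1}|^{2/d}) · 𝓘_d^{-2/d}`. -/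
def Ktilde (d : ℕ) : ℝ :=
  (2 : ℝ) ^ (6 / (d : ℝ)) * (d : ℝ) ^ 2 * (2 * Real.pi) ^ 2 /
      (((d : ℝ) + 2) ^ (2 + 4 / (d : ℝ)) * sphereArea d ^ (2 / (d : ℝ))) *
    varI d ^ (-(2 / (d : ℝ)))

end MatrixKinetic

end

/-! Write p = 2π|ξ|. Since ∫f² = 1, the kinetic symbol is p² = ∫₀^∞ f(E/p²)² dE. Hence the functions
Uₙ(x, E) with Fourier transform f(E/p²)ûₙ in x satisfy ∑ₙ∬|Uₙ|² dE dx = ∑ₙ∫|∇uₙ|²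
(`Admissible.sum_norm_sq_energyWave`). Integrating in E against w(E/μ)/μ, of squared norm W/μ with W
= ∫w², recovers g(μ/p²)ûₙ. The remainder (1 - g(μ/p²))ûₙ is controlled by Bessel's inequality for
the orthonormal ûₙ, with the bound ∫(1 - g(μ/p²))² dξ = Cμ^{d/2} (`fourierInv_decomposition`,
`sum_norm_sq_fourierInv_le`).

So for a unit vector e, ⟨e, R(x)e⟩^{1/2} ≤ (W M_e(x)/μ)^{1/2} + (Cμ^{d/2})^{1/2}, where M_e = ∑ₙ‖⟨e,
Uₙ(x,·)⟩‖². Optimizing μ bounds ⟨e, Re⟩^{1+2/d} by a multiple of W C^{2/d} M_e. Using this for each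
vector of an eigenbasis of R(x), with its own μ, and summing gives Tr R^{1+2/d} on the left and
∑ₙ‖Uₙ(x)‖² on the right (`tracePow_outerSum_le`); then integrate in x.

Both e and μ depend on x, so the exceptional null set must not depend on them: the decomposition is
made by components and for rational μ. The infimum over (f, w) is reached by continuity of c ↦
c^{-2/d} at 𝓘_d > 0. -/

open scoped FourierTransform

namespace MatrixKinetic

/-! ### Fourier transform on vector-valued L² -/

section Fourier

variable {E F G : Type*} [NormedAddCommGroup E] [InnerProductSpace ℝ E] [FiniteDimensional ℝ E]
  [MeasurableSpace E] [BorelSpace E]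
  [NormedAddCommGroup F] [InnerProductSpace ℂ F] [CompleteSpace F]
  [NormedAddCommGroup G] [InnerProductSpace ℂ G] [CompleteSpace G]

/-- Locally integrable functions with the same integrals against all Schwartz functions agree. -/
theorem ae_eq_of_integral_schwartz_smul_eq {f f' : E → F} (hf : LocallyIntegrable f)
    (hf' : LocallyIntegrable f') (h : ∀ g : 𝓢(E, ℂ), ∫ x, g x • f x = ∫ x, g x • f' x) :
    f =ᵐ[volume] f' := by
  refine ae_eq_of_integral_contDiff_smul_eq hf hf' fun g g_smooth g_cpt => ?_
  have hg₁ : HasCompactSupport (Complex.ofRealCLM ∘ g) := g_cpt.comp_left rfl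
  have hg₂ : ContDiff ℝ (⊤ : ℕ∞) (Complex.ofRealCLM ∘ g) := by fun_prop
  simpa using h (hg₁.toSchwartzMap hg₂)

/-- Two `L²` functions with the same tempered distribution are equal. -/
theorem Lp_eq_of_apply_eq {φ ψ : Lp F 2 (volume : Measure E)}
    (h : ∀ g : 𝓢(E, ℂ), ∫ x, g x • φ x = ∫ x, g x • ψ x) : φ = ψ :=
  Lp.ext (ae_eq_of_integral_schwartz_smul_eq ((Lp.memLp φ).locallyIntegrable (by norm_num))
    ((Lp.memLp ψ).locallyIntegrable (by norm_num)) h)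

omit [CompleteSpace F] in
theorem integrable_schwartz_smul (φ : Lp F 2 (volume : Measure E)) (g : 𝓢(E, ℂ)) :
    Integrable fun x => g x • φ x :=
  memLp_one_iff_integrable.1 ((Lp.memLp φ).smul (g.memLp 2) (r := 1))

/-- Defining property of the inverse Fourier transform on `L²` tested on Schwartz functions. -/
theorem integral_smul_fourierInv (φ : Lp F 2 (volume : Measure E)) (g : 𝓢(E, ℂ)) :
    ∫ x, g x • (𝓕⁻ φ : Lp F 2 (volume : Measure E)) x = ∫ x, (𝓕⁻ g) x • φ x := by
  rw [← Lp.toTemperedDistribution_apply, ← Lp.fourierInv_toTemperedDistribution_eq,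
    TemperedDistribution.fourierInv_apply, Lp.toTemperedDistribution_apply]

theorem integral_smul_compLp (L : F →L[ℂ] G) (φ : Lp F 2 (volume : Measure E)) (g : 𝓢(E, ℂ)) :
    ∫ x, g x • (L.compLp φ) x = L (∫ x, g x • φ x) := by
  rw [← L.integral_comp_comm (integrable_schwartz_smul φ g)]
  refine integral_congr_ae ?_
  filter_upwards [L.coeFn_compLp φ] with x hx
  rw [hx, L.map_smul]

/-- The inverse Fourier transform commutes with continuous linear maps of the values. -/
theorem fourierInv_compLp (L : F →L[ℂ] G) (φ : Lp F 2 (volume : Measure E)) :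
    (𝓕⁻ (L.compLp φ : Lp G 2 (volume : Measure E)) : Lp G 2 (volume : Measure E)) =
      L.compLp (𝓕⁻ φ : Lp F 2 (volume : Measure E)) := by
  refine Lp_eq_of_apply_eq fun g => ?_
  rw [integral_smul_fourierInv, integral_smul_compLp, integral_smul_compLp,
    integral_smul_fourierInv]

/-- On `L¹ ∩ L²` the inverse Fourier transform of `L²` is given by the Fourier integral. -/
theorem fourierInv_coeFn_ae_eq {φ : Lp F 2 (volume : Measure E)} (hφ : Integrable φ) :
    ⇑(𝓕⁻ φ : Lp F 2 (volume : Measure E)) =ᵐ[volume] (𝓕⁻ (⇑φ : E → F) : E → F) := by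
  have hc : Continuous (𝓕⁻ (⇑φ : E → F) : E → F) := by
    rw [Real.fourierInv_eq_fourier_comp_neg]
    exact VectorFourier.fourierIntegral_continuous Real.continuous_fourierChar
      (L := innerₗ E) continuous_inner hφ.comp_neg
  refine ae_eq_of_integral_schwartz_smul_eq ((Lp.memLp _).locallyIntegrable (by norm_num))
    hc.locallyIntegrable fun g => ?_
  rw [integral_smul_fourierInv]
  -- The form `-innerₗ E` makes this the self-adjointness of the inverse transform.
  have h := VectorFourier.integral_fourierIntegral_smul_eq_flip (μ := (volume : Measure E))
    (ν := (volume : Measure E)) (L := -innerₗ E) (f := ⇑g) (g := ⇑φ)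
    Real.continuous_fourierChar (by
      have : Continuous fun p : E × E => -(inner ℝ p.1 p.2 : ℝ) := by fun_prop
      simpa using this) g.integrable hφ
  convert h using 3 with x x
  · rw [SchwartzMap.fourierInv_coe, Real.fourierInv_eq]
    simp [VectorFourier.fourierIntegral, real_inner_comm]
  · rw [Real.fourierInv_eq]
    simp [VectorFourier.fourierIntegral, real_inner_comm]

end Fourier

theorem fourier_weakPartial {d q : ℕ} {u : L2 d q} (hu : MemH1 u) (i : Fin d) :
    ∀ᵐ ξ, (𝓕 (weakPartial hu i) : L2 d q) ξ =
      (2 * Real.pi * Complex.I * (ξ i : ℂ)) • (𝓕 u : L2 d q) ξ := by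
  refine ae_eq_of_integral_schwartz_smul_eq ((Lp.memLp _).locallyIntegrable (by norm_num)) ?_
    fun g => ?_
  · have h := (Lp.memLp (𝓕 u : L2 d q)).locallyIntegrable (by norm_num)
    have h2 := (locallyIntegrableOn_univ.2 h).continuousOn_smul (isOpen_univ.isLocallyClosed)
      (g := fun ξ : EuclideanSpace ℝ (Fin d) => (2 * Real.pi * Complex.I * (ξ i : ℂ)))
      (by fun_prop)
    exact locallyIntegrableOn_univ.1 h2
  · have h1 := congrArg (fun T => (𝓕 T) g) (weakPartial_spec hu i)
    simp only [Lp.fourier_toTemperedDistribution_eq, TemperedDistribution.fourier_lineDerivOp_eq,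
      Lp.toTemperedDistribution_apply] at h1
    rw [← h1]
    have : (fun ξ : EuclideanSpace ℝ (Fin d) =>
      ((inner ℝ ξ (EuclideanSpace.single i (1 : ℝ)) : ℝ) : ℂ)).HasTemperateGrowth := by fun_prop
    simp only [_root_.smul_apply, TemperedDistribution.smulLeftCLM_apply_apply,
      Lp.toTemperedDistribution_apply]
    rw [← integral_smul]
    refine integral_congr_ae (.of_forall fun ξ => ?_)
    simp only [SchwartzMap.smulLeftCLM_apply_apply this, smul_smul]
    congr 1
    simp [EuclideanSpace.inner_single_right]
    ring

/-! ### Logarithmic energy variable: dilations become translations -/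

section LogVariable

theorem image_exp_univ : Real.exp '' univ = Ioi (0 : ℝ) := by
  rw [image_univ, Real.range_exp]

theorem integral_Ioi_eq_integral_exp (g : ℝ → ℝ) :
    ∫ s in Ioi (0 : ℝ), g s = ∫ τ, Real.exp τ * g (Real.exp τ) := by
  rw [← image_exp_univ, integral_image_eq_integral_abs_deriv_smul MeasurableSet.univ
    (fun x _ => (Real.hasDerivAt_exp x).hasDerivWithinAt) Real.exp_injective.injOn]
  simp

theorem integrableOn_Ioi_iff_integrable_exp (g : ℝ → ℝ) :
    IntegrableOn g (Ioi (0 : ℝ)) ↔ Integrable fun τ => Real.exp τ * g (Real.exp τ) := by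
  rw [← image_exp_univ, integrableOn_image_iff_integrableOn_abs_deriv_smul MeasurableSet.univ
    (fun x _ => (Real.hasDerivAt_exp x).hasDerivWithinAt) Real.exp_injective.injOn]
  simp

theorem quasiMeasurePreserving_exp :
    Measure.QuasiMeasurePreserving Real.exp volume (volume.restrict (Ioi (0 : ℝ))) := by
  refine ⟨Real.measurable_exp, Measure.AbsolutelyContinuous.mk fun s hs h0 => ?_⟩
  rw [Measure.restrict_apply hs] at h0
  rw [Measure.map_apply Real.measurable_exp hs]
  -- Null sets are preserved because `log` is differentiable on (0, ∞).
  have : Real.exp ⁻¹' s = Real.log '' (s ∩ Ioi 0) := by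
    ext x
    constructor
    · exact fun hx => ⟨Real.exp x, ⟨hx, Real.exp_pos x⟩, Real.log_exp x⟩
    · rintro ⟨y, ⟨hy, hy0⟩, rfl⟩
      simpa [Real.exp_log hy0] using hy
  rw [this]
  refine addHaar_image_eq_zero_of_differentiableOn_of_addHaar_eq_zero volume ?_ h0
  exact fun x hx => (Real.differentiableAt_log hx.2.ne').differentiableWithinAt

/-- The isometric pullback of a function on `(0, ∞)` to the logarithmic variable. -/
noncomputable def logPull (f : ℝ → ℝ) (τ : ℝ) : ℂ := ((Real.exp (τ / 2) * f (Real.exp τ) : ℝ) : ℂ)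

theorem norm_sq_logPull (f : ℝ → ℝ) (τ : ℝ) :
    ‖logPull f τ‖ ^ 2 = Real.exp τ * f (Real.exp τ) ^ 2 := by
  rw [logPull, Complex.norm_real, Real.norm_eq_abs, sq_abs, mul_pow, ← Real.exp_nat_mul]
  congr 2
  push_cast
  ring

theorem memLp_logPull {f : ℝ → ℝ} (hf : MemLp f 2 (volume.restrict (Ioi (0 : ℝ)))) :
    MemLp (logPull f) 2 volume := by
  have hm : AEStronglyMeasurable (logPull f) volume := by
    refine Complex.continuous_ofReal.comp_aestronglyMeasurable (.mul ?_ ?_)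
    · exact (by fun_prop : Continuous fun τ : ℝ => Real.exp (τ / 2)).aestronglyMeasurable
    · exact hf.1.comp_quasiMeasurePreserving quasiMeasurePreserving_exp
  rw [memLp_two_iff_integrable_sq_norm hm]
  simp_rw [norm_sq_logPull]
  rw [← integrableOn_Ioi_iff_integrable_exp (fun s => f s ^ 2)]
  exact (memLp_two_iff_integrable_sq hf.1).1 hf

/-- The element of `L²(ℝ)` given by a function in `L²(0, ∞)` in the logarithmic variable. -/
noncomputable def logLp {f : ℝ → ℝ} (hf : MemLp f 2 (volume.restrict (Ioi (0 : ℝ)))) :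
    Lp ℂ 2 (volume : Measure ℝ) :=
  (memLp_logPull hf).toLp

theorem norm_sq_eq_integral {α F : Type*} [MeasurableSpace α] {μ : Measure α}
    [NormedAddCommGroup F] [InnerProductSpace ℂ F] (φ : Lp F 2 μ) :
    ‖φ‖ ^ 2 = ∫ x, ‖φ x‖ ^ 2 ∂μ := by
  have h : (inner ℂ φ φ : ℂ) = ∫ x, inner ℂ (φ x) (φ x) ∂μ := L2.inner_def φ φ
  simp_rw [inner_self_eq_norm_sq_to_K] at h
  have h2 : ((‖φ‖ ^ 2 : ℝ) : ℂ) = ((∫ x, ‖φ x‖ ^ 2 ∂μ : ℝ) : ℂ) := by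
    rw [← integral_complex_ofReal]
    push_cast
    exact h
  exact_mod_cast h2

theorem norm_sq_logLp {f : ℝ → ℝ} (hf : MemLp f 2 (volume.restrict (Ioi (0 : ℝ)))) :
    ‖logLp hf‖ ^ 2 = ∫ s in Ioi (0 : ℝ), f s ^ 2 := by
  rw [norm_sq_eq_integral, integral_Ioi_eq_integral_exp]
  refine integral_congr_ae ?_
  filter_upwards [(memLp_logPull hf).coeFn_toLp] with τ hτ
  rw [logLp, hτ, norm_sq_logPull]

/-- Translation on `L²(ℝ)`. -/
noncomputable def translate (a : ℝ) (ψ : Lp ℂ 2 (volume : Measure ℝ)) :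
    Lp ℂ 2 (volume : Measure ℝ) :=
  Lp.compMeasurePreserving (· + a) (measurePreserving_add_right volume a) ψ

theorem translate_coeFn (a : ℝ) (ψ : Lp ℂ 2 (volume : Measure ℝ)) :
    translate a ψ =ᵐ[volume] fun τ => ψ (τ + a) :=
  Lp.coeFn_compMeasurePreserving ψ (measurePreserving_add_right volume a)

theorem norm_translate (a : ℝ) (ψ : Lp ℂ 2 (volume : Measure ℝ)) : ‖translate a ψ‖ = ‖ψ‖ :=
  Lp.norm_compMeasurePreserving ψ (measurePreserving_add_right volume a)

/-- Strong continuity of translations yields both the continuity of g and the measurability of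
`energyVec` in ξ. -/
theorem continuous_translate (ψ : Lp ℂ 2 (volume : Measure ℝ)) :
    Continuous fun a => translate a ψ := by
  have hg : Continuous fun a : ℝ => (⟨(· + a), by fun_prop⟩ : C(ℝ, ℝ)) :=
    (ContinuousMap.curry ⟨fun p : ℝ × ℝ => p.2 + p.1, by fun_prop⟩).continuous
  exact continuous_const.compMeasurePreservingLp hg
    (fun a => measurePreserving_add_right volume a) (by norm_num)

theorem inner_translate_translate (a b : ℝ) (ψ φ : Lp ℂ 2 (volume : Measure ℝ)) :
    (inner ℂ (translate a ψ) (translate b φ) : ℂ) = inner ℂ ψ (translate (b - a) φ) := by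
  rw [L2.inner_def, L2.inner_def,
    ← integral_add_right_eq_self (fun τ => inner ℂ (ψ τ) (translate (b - a) φ τ)) a]
  refine integral_congr_ae ?_
  filter_upwards [translate_coeFn a ψ, translate_coeFn b φ,
    (measurePreserving_add_right volume a).quasiMeasurePreserving.ae (translate_coeFn (b - a) φ)]
    with τ h1 h2 h3
  rw [h1, h2, h3]
  ring_nf

/-- Up to the Jacobian factor e^{b/2}, g is a matrix coefficient of the translation group. -/
theorem inner_logLp_translate {f w : ℝ → ℝ} (hf : MemLp f 2 (volume.restrict (Ioi (0 : ℝ))))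
    (hw : MemLp w 2 (volume.restrict (Ioi (0 : ℝ)))) (b : ℝ) :
    (inner ℂ (logLp hw) (translate b (logLp hf)) : ℂ) =
      ((Real.exp (b / 2) * gFun f w (Real.exp b) : ℝ) : ℂ) := by
  rw [L2.inner_def, gFun, integral_Ioi_eq_integral_exp, ← integral_const_mul,
    ← integral_complex_ofReal]
  refine integral_congr_ae ?_
  filter_upwards [translate_coeFn b (logLp hf), (memLp_logPull hw).coeFn_toLp,
    (measurePreserving_add_right volume b).quasiMeasurePreserving.ae (memLp_logPull hf).coeFn_toLp]
    with τ h1 h2 h3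
  rw [h1, logLp, logLp, h2, h3, logPull, logPull]
  simp only [RCLike.inner_apply, Complex.conj_ofReal]
  rw [← Complex.ofReal_mul]
  congr 1
  have h4 : Real.exp ((τ + b) / 2) * Real.exp (τ / 2) = Real.exp (b / 2) * Real.exp τ := by
    rw [← Real.exp_add, ← Real.exp_add]
    congr 1
    ring
  rw [Real.exp_add τ b]
  linear_combination w (Real.exp τ) * f (Real.exp τ * Real.exp b) * h4

theorem gFun_eq {f w : ℝ → ℝ} (hf : MemLp f 2 (volume.restrict (Ioi (0 : ℝ))))
    (hw : MemLp w 2 (volume.restrict (Ioi (0 : ℝ)))) {t : ℝ} (ht : 0 < t) :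
    gFun f w t = (√t)⁻¹ * (inner ℂ (logLp hw) (translate (Real.log t) (logLp hf)) : ℂ).re := by
  rw [inner_logLp_translate, Complex.ofReal_re, Real.exp_log ht, Real.exp_half, Real.exp_log ht,
    inv_mul_cancel_left₀ (Real.sqrt_pos.2 ht).ne']

theorem continuousOn_gFun {f w : ℝ → ℝ} (hf : MemLp f 2 (volume.restrict (Ioi (0 : ℝ))))
    (hw : MemLp w 2 (volume.restrict (Ioi (0 : ℝ)))) : ContinuousOn (gFun f w) (Ioi 0) := by
  have : ContinuousOn (fun t => (√t)⁻¹ *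
      (inner ℂ (logLp hw) (translate (Real.log t) (logLp hf)) : ℂ).re) (Ioi 0) := by
    refine ContinuousOn.mul (Real.continuous_sqrt.continuousOn.inv₀
      fun t ht => (Real.sqrt_pos.2 ht).ne') ?_
    refine Complex.continuous_re.comp_continuousOn (continuousOn_const.inner ?_)
    exact (continuous_translate _).comp_continuousOn
      (Real.continuousOn_log.mono fun t ht => (ne_of_gt ht : t ≠ 0))
  exact this.congr fun t ht => gFun_eq hf hw ht

theorem abs_gFun_le {f w : ℝ → ℝ} (hf : MemLp f 2 (volume.restrict (Ioi (0 : ℝ))))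
    (hw : MemLp w 2 (volume.restrict (Ioi (0 : ℝ)))) {t : ℝ} (ht : 0 < t) :
    |gFun f w t| ≤ (√t)⁻¹ * (‖logLp hw‖ * ‖logLp hf‖) := by
  rw [gFun_eq hf hw ht, abs_mul, abs_of_nonneg (by positivity)]
  gcongr
  refine (Complex.abs_re_le_norm _).trans ((norm_inner_le_norm _ _).trans_eq ?_)
  rw [norm_translate]

end LogVariable

/-! ### Positivity and finiteness of the variational quantity -/

section Variational

theorem Admissible.norm_logLp_f {d : ℕ} {f w : ℝ → ℝ} (h : Admissible d f w) :
    ‖logLp h.f_memLp‖ = 1 := by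
  have := norm_sq_logLp h.f_memLp
  rw [h.f_norm] at this
  exact (pow_eq_one_iff_of_nonneg (norm_nonneg _) two_ne_zero).1 this

theorem Admissible.abs_gFun_le {d : ℕ} {f w : ℝ → ℝ} (h : Admissible d f w) {t : ℝ} (ht : 0 < t) :
    |gFun f w t| ≤ (√t)⁻¹ * √(∫ s in Ioi (0 : ℝ), w s ^ 2) := by
  have := MatrixKinetic.abs_gFun_le h.f_memLp h.w_memLp ht
  rwa [h.norm_logLp_f, mul_one, ← Real.sqrt_sq (norm_nonneg (logLp h.w_memLp)),
    norm_sq_logLp] at this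

/-- If ∫w² = 0 then g = 0, and the defect integrand is a pure power, never integrable on all of (0,
∞). -/
theorem Admissible.integral_w_sq_pos {d : ℕ} {f w : ℝ → ℝ} (h : Admissible d f w) :
    0 < ∫ s in Ioi (0 : ℝ), w s ^ 2 := by
  refine (integral_nonneg fun s => sq_nonneg (w s)).lt_of_ne fun h0 => ?_
  have hg : ∀ t ∈ Ioi (0 : ℝ), (1 - gFun f w t) ^ 2 / t ^ (1 + (d : ℝ) / 2) =
      t ^ (-(1 + (d : ℝ) / 2)) := by
    intro t ht
    have := h.abs_gFun_le ht
    rw [← h0, Real.sqrt_zero, mul_zero, abs_nonpos_iff] at this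
    rw [this, Real.rpow_neg (le_of_lt ht)]
    simp
  exact not_integrableOn_Ioi_rpow _ (h.defect_finite.congr_fun hg measurableSet_Ioi)

/-- Cauchy–Schwarz gives |g(t)| ≤ (W/t)^{1/2}, so g ≤ 1/2 for t > 4W. There the defect integrand is
at least t^{-1-d/2}/4, and the resulting power of W cancels against W^{d/2}, leaving a bound uniform
over competitors. -/
theorem Admissible.le_value {d : ℕ} (hd : 1 ≤ d) {f w : ℝ → ℝ} (h : Admissible d f w) :
    (4 : ℝ) ^ (-((d : ℝ) / 2)) / (2 * d) ≤
      (∫ s in Ioi (0 : ℝ), w s ^ 2) ^ ((d : ℝ) / 2) * gDefect d f w := by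
  set W := ∫ s in Ioi (0 : ℝ), w s ^ 2 with hW
  have hW0 : 0 < W := h.integral_w_sq_pos
  have hd0 : (0 : ℝ) < d := by exact_mod_cast hd
  have key : (4 * W) ^ (-((d : ℝ) / 2)) / (2 * d) ≤ gDefect d f w := by
    have hsub : Ioi (4 * W) ⊆ Ioi (0 : ℝ) := Ioi_subset_Ioi (by positivity)
    calc (4 * W) ^ (-((d : ℝ) / 2)) / (2 * d)
        = ∫ t in Ioi (4 * W), (1 / 4 : ℝ) * t ^ (-(1 + (d : ℝ) / 2)) := by
          rw [integral_const_mul, integral_Ioi_rpow_of_lt (by linarith) (by positivity)]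
          rw [show -(1 + (d : ℝ) / 2) + 1 = -((d : ℝ) / 2) by ring]
          field_simp
          ring
      _ ≤ ∫ t in Ioi (4 * W), (1 - gFun f w t) ^ 2 / t ^ (1 + (d : ℝ) / 2) := by
          refine setIntegral_mono_on ((integrableOn_Ioi_rpow_of_lt (by linarith)
            (by positivity)).const_mul _) (h.defect_finite.mono_set hsub) measurableSet_Ioi ?_
          intro t ht
          have ht0 : 0 < t := hsub ht
          have hg : gFun f w t ≤ 1 / 2 := by
            refine (le_abs_self _).trans ((h.abs_gFun_le ht0).trans ?_)
            rw [inv_mul_le_iff₀ (Real.sqrt_pos.2 ht0)]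
            refine Real.sqrt_le_iff.2 ⟨by positivity, ?_⟩
            rw [mul_pow, Real.sq_sqrt ht0.le]
            linarith [mem_Ioi.1 ht]
          rw [Real.rpow_neg ht0.le, ← div_eq_mul_inv]
          gcongr
          nlinarith
      _ ≤ gDefect d f w := by
          refine setIntegral_mono_set h.defect_finite ?_ hsub.eventuallyLE
          filter_upwards [self_mem_ae_restrict measurableSet_Ioi] with t ht
          have : 0 < t := ht
          simp only [Pi.zero_apply]
          positivity
  calc (4 : ℝ) ^ (-((d : ℝ) / 2)) / (2 * d)
      = W ^ ((d : ℝ) / 2) * ((4 * W) ^ (-((d : ℝ) / 2)) / (2 * d)) := by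
        rw [Real.mul_rpow (by norm_num) hW0.le, Real.rpow_neg hW0.le]
        have : W ^ ((d : ℝ) / 2) ≠ 0 := (Real.rpow_pos_of_pos hW0 _).ne'
        field_simp
    _ ≤ _ := by gcongr

theorem gFun_indicator {t : ℝ} (ht : 0 < t) :
    gFun ((Ioc (0 : ℝ) 1).indicator 1) ((Ioc (0 : ℝ) 1).indicator 1) t = min 1 t⁻¹ := by
  have h : ∀ s ∈ Ioi (0 : ℝ), (Ioc (0 : ℝ) 1).indicator (1 : ℝ → ℝ) s *
      (Ioc (0 : ℝ) 1).indicator (1 : ℝ → ℝ) (s * t) =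
      (Ioc (0 : ℝ) (min 1 t⁻¹)).indicator (1 : ℝ → ℝ) s := by
    intro s hs
    have hs0 : 0 < s := hs
    have hst : 0 < s * t := by positivity
    have h3 : s * t ≤ 1 ↔ s ≤ t⁻¹ := by rw [← one_div, le_div_iff₀ ht]
    by_cases h1 : s ≤ 1 <;> by_cases h2 : s ≤ t⁻¹ <;>
      simp [indicator, hs0, ht, h1, h2, h3]
  rw [gFun, setIntegral_congr_fun measurableSet_Ioi h, setIntegral_indicator measurableSet_Ioc,
    inter_eq_self_of_subset_right Ioc_subset_Ioi_self]
  simp [ht.le]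

/-- For f = w = 1_{(0,1]} one has g = min(1, 1/t): the defect vanishes on (0, 1] and is at most
t^{-1-d/2} beyond. -/
theorem exists_admissible (d : ℕ) (hd : 1 ≤ d) : ∃ f w : ℝ → ℝ, Admissible d f w := by
  have hd0 : (0 : ℝ) < d := by exact_mod_cast hd
  have hmem : MemLp ((Ioc (0 : ℝ) 1).indicator (1 : ℝ → ℝ)) 2 (volume.restrict (Ioi (0 : ℝ))) :=
    memLp_indicator_const 2 measurableSet_Ioc (1 : ℝ)
      (.inr ((Measure.restrict_apply_le _ _).trans_lt (by simp)).ne)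
  have hnn : ∀ s ∈ Ioi (0 : ℝ), 0 ≤ (Ioc (0 : ℝ) 1).indicator (1 : ℝ → ℝ) s := fun s _ =>
    indicator_nonneg (fun _ _ => zero_le_one) s
  refine ⟨_, _, ⟨hnn, hnn, hmem, hmem, ?_, ?_⟩⟩
  · have : ∀ s : ℝ, (Ioc (0 : ℝ) 1).indicator (1 : ℝ → ℝ) s ^ 2 =
        (Ioc (0 : ℝ) 1).indicator (1 : ℝ → ℝ) s := fun s => by
      by_cases h : s ∈ Ioc (0 : ℝ) 1 <;> simp [h]
    simp_rw [this]
    rw [setIntegral_indicator measurableSet_Ioc,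
      inter_eq_self_of_subset_right Ioc_subset_Ioi_self]
    simp
  · have h1 : IntegrableOn (fun t : ℝ => (1 - min 1 t⁻¹) ^ 2 / t ^ (1 + (d : ℝ) / 2))
        (Ioi (0 : ℝ)) := by
      rw [← Ioc_union_Ioi_eq_Ioi zero_le_one]
      refine IntegrableOn.union ?_ ?_
      · refine (integrableOn_zero).congr_fun (f := fun _ => (0 : ℝ)) (fun t ht => ?_)
          measurableSet_Ioc
        rw [min_eq_left (one_le_inv_iff₀.2 ht)]
        simp
      · refine Integrable.mono' (integrableOn_Ioi_rpow_of_lt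
          (a := -(1 + (d : ℝ) / 2)) (by linarith) one_pos)
          (by fun_prop : Measurable _).aestronglyMeasurable ?_
        filter_upwards [self_mem_ae_restrict measurableSet_Ioi] with t ht
        have ht0 : (0 : ℝ) < t := one_pos.trans ht
        have h0 : 0 ≤ min 1 t⁻¹ := by positivity
        have h1 : min 1 t⁻¹ ≤ 1 := min_le_left _ _
        rw [Real.norm_of_nonneg (by positivity), Real.rpow_neg ht0.le, div_eq_mul_inv]
        exact mul_le_of_le_one_left (by positivity) (by nlinarith)
    exact h1.congr_fun (fun t ht => by simp only [gFun_indicator ht]) measurableSet_Ioi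

theorem varI_pos {d : ℕ} (hd : 1 ≤ d) : 0 < varI d := by
  have hd0 : (0 : ℝ) < d := by exact_mod_cast hd
  obtain ⟨f, w, h⟩ := exists_admissible d hd
  refine lt_of_lt_of_le (by positivity : 0 < (4 : ℝ) ^ (-((d : ℝ) / 2)) / (2 * d)) ?_
  refine le_csInf ⟨_, f, w, h, rfl⟩ ?_
  rintro c ⟨f, w, h, rfl⟩
  exact h.le_value hd

end Variational

/-! ### Lift to the energy variable and the averaging decomposition -/

section EnergyLift

variable {d : ℕ} {f w : ℝ → ℝ}

/-- The vector of `L²(ℝ)` that represents `E ↦ f(E / p²)`, `p = 2π‖ξ‖`, in the variable `log E`. -/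
noncomputable def energyVec (hf : MemLp f 2 (volume.restrict (Ioi (0 : ℝ))))
    (ξ : EuclideanSpace ℝ (Fin d)) : Lp ℂ 2 (volume : Measure ℝ) :=
  ((2 * Real.pi * ‖ξ‖ : ℝ) : ℂ) • translate (-Real.log ((2 * Real.pi * ‖ξ‖) ^ 2)) (logLp hf)

/-- The vector of `L²(ℝ)` that represents `E ↦ w(E / μ) / μ` in the variable `log E`. -/
noncomputable def weightVec (hw : MemLp w 2 (volume.restrict (Ioi (0 : ℝ)))) (μ : ℝ) :
    Lp ℂ 2 (volume : Measure ℝ) :=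
  (((√μ)⁻¹ : ℝ) : ℂ) • translate (-Real.log μ) (logLp hw)

theorem stronglyMeasurable_energyVec (hf : MemLp f 2 (volume.restrict (Ioi (0 : ℝ)))) :
    StronglyMeasurable (energyVec (d := d) hf) := by
  refine StronglyMeasurable.smul (f := fun ξ : EuclideanSpace ℝ (Fin d) =>
    ((2 * Real.pi * ‖ξ‖ : ℝ) : ℂ)) (Continuous.stronglyMeasurable (by fun_prop)) ?_
  · refine (continuous_translate (logLp hf)).comp_stronglyMeasurable ?_
    exact (by fun_prop : Measurable fun ξ : EuclideanSpace ℝ (Fin d) =>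
      -Real.log ((2 * Real.pi * ‖ξ‖) ^ 2)).stronglyMeasurable

/-- This is the layer identity ∫f(E/p²)² dE = p²∫f², the source of the kinetic energy. -/
theorem norm_energyVec (hf : MemLp f 2 (volume.restrict (Ioi (0 : ℝ))))
    (ξ : EuclideanSpace ℝ (Fin d)) :
    ‖energyVec hf ξ‖ = 2 * Real.pi * ‖ξ‖ * ‖logLp hf‖ := by
  rw [energyVec, norm_smul, norm_translate, Complex.norm_real, Real.norm_of_nonneg (by positivity)]

theorem norm_sq_weightVec (hw : MemLp w 2 (volume.restrict (Ioi (0 : ℝ)))) {μ : ℝ} (hμ : 0 < μ) :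
    ‖weightVec hw μ‖ ^ 2 = (∫ s in Ioi (0 : ℝ), w s ^ 2) / μ := by
  rw [weightVec, norm_smul, norm_translate, Complex.norm_real, Real.norm_of_nonneg (by positivity),
    mul_pow, norm_sq_logLp, inv_pow, Real.sq_sqrt hμ.le, inv_mul_eq_div]

/-- Substitute E = μs in μ⁻¹∫w(E/μ) f(E/p²) dE. At ξ = 0 `energyVec` is zero and the quotient is a
default value; that null set is excluded. -/
theorem inner_weightVec_energyVec (hf : MemLp f 2 (volume.restrict (Ioi (0 : ℝ))))
    (hw : MemLp w 2 (volume.restrict (Ioi (0 : ℝ)))) {μ : ℝ} (hμ : 0 < μ)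
    {ξ : EuclideanSpace ℝ (Fin d)} (hξ : ξ ≠ 0) :
    (inner ℂ (weightVec hw μ) (energyVec hf ξ) : ℂ) =
      ((gFun f w (μ / (2 * Real.pi * ‖ξ‖) ^ 2) : ℝ) : ℂ) := by
  have hp : 0 < 2 * Real.pi * ‖ξ‖ := by have := norm_pos_iff.2 hξ; positivity
  set p := 2 * Real.pi * ‖ξ‖ with hpdef
  have hl : -Real.log (p ^ 2) - -Real.log μ = Real.log (μ / p ^ 2) := by
    rw [Real.log_div hμ.ne' (by positivity)]
    ring
  rw [weightVec, energyVec, inner_smul_left, inner_smul_right, inner_translate_translate, hl,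
    inner_logLp_translate, Complex.conj_ofReal, ← Complex.ofReal_mul, ← Complex.ofReal_mul]
  congr 1
  rw [Real.exp_half, Real.exp_log (by positivity), Real.sqrt_div hμ.le, Real.sqrt_sq hp.le]
  have : √μ ≠ 0 := (Real.sqrt_pos.2 hμ).ne'
  rw [← hpdef]
  field_simp

theorem memLp_smul_energyVec (hf : MemLp f 2 (volume.restrict (Ioi (0 : ℝ))))
    {φ : EuclideanSpace ℝ (Fin d) → ℂ} (hφm : AEStronglyMeasurable φ)
    (hφ : MemLp (fun ξ => (‖ξ‖ : ℂ) * φ ξ) 2) :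
    MemLp (fun ξ => φ ξ • energyVec hf ξ) 2 := by
  refine MemLp.of_le_mul (c := 2 * Real.pi * ‖logLp hf‖) hφ
    (hφm.smul (stronglyMeasurable_energyVec hf).aestronglyMeasurable) (.of_forall fun ξ => ?_)
  rw [norm_smul, norm_energyVec, norm_mul, Complex.norm_real, norm_norm]
  apply le_of_eq
  ring

/-- The multiple `φ(ξ) f(E / p²)`, as a function of `ξ` with values in `L²(ℝ)`. -/
noncomputable def energyLift (hf : MemLp f 2 (volume.restrict (Ioi (0 : ℝ))))
    (φ : Lp ℂ 2 (volume : Measure (EuclideanSpace ℝ (Fin d))))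
    (hφ : MemLp (fun ξ => (‖ξ‖ : ℂ) * φ ξ) 2) :
    Lp (Lp ℂ 2 (volume : Measure ℝ)) 2 (volume : Measure (EuclideanSpace ℝ (Fin d))) :=
  (memLp_smul_energyVec hf (Lp.aestronglyMeasurable φ) hφ).toLp

theorem norm_sq_energyLift (hf : MemLp f 2 (volume.restrict (Ioi (0 : ℝ))))
    (φ : Lp ℂ 2 (volume : Measure (EuclideanSpace ℝ (Fin d))))
    (hφ : MemLp (fun ξ => (‖ξ‖ : ℂ) * φ ξ) 2) (hf1 : ‖logLp hf‖ = 1) :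
    ‖energyLift hf φ hφ‖ ^ 2 = ∫ ξ, (2 * Real.pi * ‖ξ‖) ^ 2 * ‖φ ξ‖ ^ 2 := by
  rw [norm_sq_eq_integral]
  refine integral_congr_ae ?_
  filter_upwards [(memLp_smul_energyVec hf (Lp.aestronglyMeasurable φ) hφ).coeFn_toLp] with ξ h
  rw [energyLift, h, norm_smul, norm_energyVec, hf1]
  ring

/-- The symbol `1 - g(μ / p²)`, `p = 2π‖ξ‖`. -/
noncomputable def defectSymbol (f w : ℝ → ℝ) (μ : ℝ) (ξ : EuclideanSpace ℝ (Fin d)) : ℝ :=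
  1 - gFun f w (μ / (2 * Real.pi * ‖ξ‖) ^ 2)

theorem integral_Ioi_defect (hd : 1 ≤ d) {μ : ℝ} (hμ : 0 < μ) :
    (IntegrableOn (fun t : ℝ => (1 - gFun f w t) ^ 2 / t ^ (1 + (d : ℝ) / 2)) (Ioi (0 : ℝ)) →
      IntegrableOn (fun y : ℝ => y ^ (d - 1) • (1 - gFun f w (μ / (2 * Real.pi * y) ^ 2)) ^ 2)
        (Ioi 0)) ∧
    ∫ y in Ioi (0 : ℝ), y ^ (d - 1) • (1 - gFun f w (μ / (2 * Real.pi * y) ^ 2)) ^ 2 =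
      μ ^ ((d : ℝ) / 2) / (2 * (2 * Real.pi) ^ d) * gDefect d f w := by
  -- With x = by, the argument μ/(2πy)² is x⁻². The change of variables t = x⁻² then turns
  -- t^{-1-d/2} dt into 2x^{d-1} dx, the radial density.
  set b : ℝ := 2 * Real.pi / √μ with hb
  have hsμ : 0 < √μ := Real.sqrt_pos.2 hμ
  have hb0 : 0 < b := by positivity
  set F : ℝ → ℝ := fun t => (1 - gFun f w t) ^ 2 / t ^ (1 + (d : ℝ) / 2) with hF
  have hd1 : ((d - 1 : ℕ) : ℝ) = (d : ℝ) - 1 := by push_cast [hd]; ring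
  have e1 : ∀ x ∈ Ioi (0 : ℝ), (|(-2 : ℝ)| * x ^ ((-2 : ℝ) - 1)) • F (x ^ (-2 : ℝ)) =
      2 * (x ^ (d - 1) * (1 - gFun f w ((x ^ 2)⁻¹)) ^ 2) := by
    intro x hx
    have hx0 : 0 < x := hx
    have h2 : x ^ (-2 : ℝ) = (x ^ 2)⁻¹ := by
      rw [Real.rpow_neg hx0.le]; norm_cast
    have h3 : x ^ ((-2 : ℝ) - 1) / (x ^ (-2 : ℝ)) ^ (1 + (d : ℝ) / 2) = x ^ (d - 1) := by
      rw [← Real.rpow_mul hx0.le, ← Real.rpow_sub hx0, ← Real.rpow_natCast x (d - 1), hd1]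
      congr 1
      ring
    rw [hF, ← h3, ← h2]
    simp only [smul_eq_mul, abs_neg, Nat.abs_ofNat]
    ring
  have e2 : ∀ y ∈ Ioi (0 : ℝ), (y ^ (d - 1) • (1 - gFun f w (μ / (2 * Real.pi * y) ^ 2)) ^ 2 : ℝ) =
      (2 * b ^ (d - 1))⁻¹ *
        (2 * ((b * y) ^ (d - 1) * (1 - gFun f w (((b * y) ^ 2)⁻¹)) ^ 2)) := by
    intro y hy
    have hy0 : 0 < y := hy
    have h1 : μ / (2 * Real.pi * y) ^ 2 = ((b * y) ^ 2)⁻¹ := by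
      rw [hb]
      field_simp
      rw [Real.sq_sqrt hμ.le]
    rw [h1, mul_pow b y (d - 1)]
    simp only [smul_eq_mul]
    field_simp
  constructor
  · intro hFi
    have h1 := (integrableOn_Ioi_comp_rpow_iff F (p := -2) (by norm_num)).2 hFi
    have h2 := h1.congr_fun e1 measurableSet_Ioi
    have h3 := (integrableOn_Ioi_comp_mul_left_iff (fun x : ℝ =>
      2 * (x ^ (d - 1) * (1 - gFun f w ((x ^ 2)⁻¹)) ^ 2)) 0 hb0).2 (by simpa using h2)
    exact IntegrableOn.congr_fun (h3.const_mul ((2 * b ^ (d - 1))⁻¹))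
      (fun y hy => (e2 y hy).symm) measurableSet_Ioi
  · rw [setIntegral_congr_fun measurableSet_Ioi e2, integral_const_mul,
      integral_comp_mul_left_Ioi (fun x : ℝ =>
        2 * (x ^ (d - 1) * (1 - gFun f w ((x ^ 2)⁻¹)) ^ 2)) 0 hb0, mul_zero,
      ← setIntegral_congr_fun measurableSet_Ioi e1, integral_comp_rpow_Ioi F (by norm_num)]
    have hbd : b ^ (d - 1) * b = (2 * Real.pi) ^ d / μ ^ ((d : ℝ) / 2) := by
      rw [← pow_succ, Nat.sub_add_cancel hd, hb, div_pow, Real.sqrt_eq_rpow, ← Real.rpow_mul_natCast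
        hμ.le]
      congr 2
      ring
    rw [gDefect, smul_eq_mul, ← mul_assoc]
    congr 1
    rw [← mul_inv, mul_assoc, hbd]
    field_simp

theorem norm_sq_defectSymbol (hd : 1 ≤ d) (h : Admissible d f w) {μ : ℝ} (hμ : 0 < μ) :
    MemLp (defectSymbol (d := d) f w μ) 2 ∧
    ∫ ξ, defectSymbol (d := d) f w μ ξ ^ 2 =
      sphereArea d * gDefect d f w / (2 * (2 * Real.pi) ^ d) * μ ^ ((d : ℝ) / 2) := by
  obtain ⟨h1, h2⟩ := integral_Ioi_defect (f := f) (w := w) hd hμ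
  have : Nonempty (Fin d) := ⟨⟨0, hd⟩⟩
  have hm : AEStronglyMeasurable (defectSymbol (d := d) f w μ) := by
    -- Continuity off the origin suffices for measurability, as points are null when d ≥ 1.
    have hc : ContinuousOn (defectSymbol (d := d) f w μ) {0}ᶜ := by
      refine continuousOn_const.sub ((continuousOn_gFun h.f_memLp h.w_memLp).comp ?_ ?_)
      · refine ContinuousOn.div continuousOn_const (by fun_prop) fun ξ hξ => ?_
        have : 0 < ‖ξ‖ := norm_pos_iff.2 hξ
        positivity
      · intro ξ hξ
        have : 0 < ‖ξ‖ := norm_pos_iff.2 hξ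
        simp only [mem_Ioi]
        positivity
    have := hc.aestronglyMeasurable (μ := volume) (measurableSet_singleton _).compl
    rwa [restrict_compl_singleton] at this
  constructor
  · rw [memLp_two_iff_integrable_sq hm]
    refine (integrable_fun_norm_addHaar (volume : Measure (EuclideanSpace ℝ (Fin d)))
      (f := fun y => (1 - gFun f w (μ / (2 * Real.pi * y) ^ 2)) ^ 2)).2 ?_
    simpa using h1 h.defect_finite
  · have h3 := integral_fun_norm_addHaar (volume : Measure (EuclideanSpace ℝ (Fin d)))
      (fun y => (1 - gFun f w (μ / (2 * Real.pi * y) ^ 2)) ^ 2)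
    simp only [defectSymbol]
    rw [h3, finrank_euclideanSpace, Fintype.card_fin, h2, sphereArea,
      Measure.toSphere_real_apply_univ, finrank_euclideanSpace, Fintype.card_fin]
    simp only [smul_eq_mul, nsmul_eq_mul]
    ring

/-- Decomposition of an `L²` function into its energy-averaged part and a remainder, given by a
Fourier integral. -/
theorem fourierInv_decomposition (hd : 1 ≤ d) (h : Admissible d f w) {μ : ℝ} (hμ : 0 < μ)
    (φ : Lp ℂ 2 (volume : Measure (EuclideanSpace ℝ (Fin d))))
    (hφ : MemLp (fun ξ => (‖ξ‖ : ℂ) * φ ξ) 2) :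
    ∀ᵐ x, (𝓕⁻ φ : Lp ℂ 2 (volume : Measure (EuclideanSpace ℝ (Fin d)))) x =
      inner ℂ (weightVec h.w_memLp μ) ((𝓕⁻ (energyLift h.f_memLp φ hφ) :
        Lp (Lp ℂ 2 (volume : Measure ℝ)) 2 (volume : Measure (EuclideanSpace ℝ (Fin d)))) x) +
      𝓕⁻ (fun ξ => (defectSymbol f w μ ξ : ℂ) * φ ξ) x := by
  have : Nonempty (Fin d) := ⟨⟨0, hd⟩⟩
  set Φ := energyLift h.f_memLp φ hφ with hΦ
  set A : Lp ℂ 2 (volume : Measure (EuclideanSpace ℝ (Fin d))) :=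
    (innerSL ℂ (weightVec h.w_memLp μ)).compLp Φ with hA
  have hne : ∀ᵐ ξ : EuclideanSpace ℝ (Fin d), ξ ≠ 0 := by
    simp [ae_iff]
  have hB : ⇑(φ - A) =ᵐ[volume] fun ξ => (defectSymbol f w μ ξ : ℂ) * φ ξ := by
    filter_upwards [Lp.coeFn_sub φ A, (innerSL ℂ (weightVec h.w_memLp μ)).coeFn_compLp Φ,
      (memLp_smul_energyVec h.f_memLp (Lp.aestronglyMeasurable φ) hφ).coeFn_toLp, hne]
      with ξ h1 h2 h3 h4
    rw [h1, Pi.sub_apply, hA, h2, hΦ, energyLift, h3, innerSL_apply_apply, inner_smul_right,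
      inner_weightVec_energyVec h.f_memLp h.w_memLp hμ h4, defectSymbol]
    push_cast
    ring
  -- A product of two L² functions is integrable, so the remainder is an honest Fourier integral,
  -- defined at every x.
  have hBi : Integrable ⇑(φ - A) := by
    refine Integrable.congr ?_ hB.symm
    exact memLp_one_iff_integrable.1 ((Lp.memLp φ).mul
      ((norm_sq_defectSymbol hd h hμ).1.ofReal (K := ℂ)) (r := 1))
  have hsub : (𝓕⁻ φ : Lp ℂ 2 (volume : Measure (EuclideanSpace ℝ (Fin d)))) =
      (innerSL ℂ (weightVec h.w_memLp μ)).compLp (𝓕⁻ Φ) +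
        (𝓕⁻ (φ - A) : Lp ℂ 2 (volume : Measure (EuclideanSpace ℝ (Fin d)))) := by
    rw [← fourierInv_compLp, ← hA, ← FourierInvAdd.fourierInv_add, add_sub_cancel]
  rw [hsub]
  filter_upwards [Lp.coeFn_add ((innerSL ℂ (weightVec h.w_memLp μ)).compLp (𝓕⁻ Φ))
    (𝓕⁻ (φ - A) : Lp ℂ 2 (volume : Measure (EuclideanSpace ℝ (Fin d)))),
    (innerSL ℂ (weightVec h.w_memLp μ)).coeFn_compLp (𝓕⁻ Φ : Lp (Lp ℂ 2 (volume : Measure ℝ)) 2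
      (volume : Measure (EuclideanSpace ℝ (Fin d)))), fourierInv_coeFn_ae_eq hBi] with x h1 h2 h3
  rw [h1, Pi.add_apply, h2, h3, innerSL_apply_apply]
  congr 1
  rw [Real.fourierInv_eq, Real.fourierInv_eq]
  refine integral_congr_ae ?_
  filter_upwards [hB] with ξ h4
  rw [h4]

end EnergyLift

/-- Bessel's inequality for Fourier integrals of an orthonormal family. -/
theorem sum_norm_sq_fourierInv_le {d q N : ℕ} {v : Fin N → L2 d q} (hv : Orthonormal ℂ v)
    {m : EuclideanSpace ℝ (Fin d) → ℝ} (hm : MemLp m 2) (e : EuclideanSpace ℂ (Fin q))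
    (x : EuclideanSpace ℝ (Fin d)) :
    ∑ n, ‖∑ j, star (e j) * 𝓕⁻ (fun ξ => (m ξ : ℂ) * v n ξ j) x‖ ^ 2 ≤
      (∫ ξ, m ξ ^ 2) * ‖e‖ ^ 2 := by
  -- The conjugated Fourier kernel times m: each summand becomes the modulus of an inner product of
  -- vₙ with c·e in L².
  set c : EuclideanSpace ℝ (Fin d) → ℂ := fun ξ =>
    star (Complex.exp ((2 * Real.pi * inner ℝ ξ x : ℝ) * Complex.I)) * (m ξ : ℂ) with hc
  have hcn : ∀ ξ, ‖c ξ‖ = ‖m ξ‖ := fun ξ => by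
    rw [hc, norm_mul, norm_star, Complex.norm_exp_ofReal_mul_I, one_mul, Complex.norm_real]
  have hcm : AEStronglyMeasurable c := by
    refine AEStronglyMeasurable.mul ?_ (Complex.continuous_ofReal.comp_aestronglyMeasurable hm.1)
    exact (by fun_prop : Continuous fun ξ : EuclideanSpace ℝ (Fin d) =>
      star (Complex.exp ((2 * Real.pi * inner ℝ ξ x : ℝ) * Complex.I))).aestronglyMeasurable
  have hk : MemLp (fun ξ => c ξ • e) 2 := by
    refine MemLp.of_le_mul (c := ‖e‖) hm (hcm.smul aestronglyMeasurable_const)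
      (.of_forall fun ξ => ?_)
    rw [norm_smul, hcn, mul_comm]
  have hint : ∀ n j, Integrable fun ξ : EuclideanSpace ℝ (Fin d) =>
      star (e j) * (Complex.exp ((2 * Real.pi * inner ℝ ξ x : ℝ) * Complex.I) * ((m ξ : ℂ) * v n ξ j)) := by
    intro n j
    refine Integrable.const_mul ?_ _
    have h1 : MemLp (fun ξ => v n ξ j) 2 :=
      (EuclideanSpace.proj (𝕜 := ℂ) j).comp_memLp' (Lp.memLp (v n))
    have h2 : Integrable fun ξ => (m ξ : ℂ) * v n ξ j :=
      memLp_one_iff_integrable.1 (h1.mul (hm.ofReal (K := ℂ)) (r := 1))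
    refine h2.bdd_mul (c := 1) ?_ (.of_forall fun ξ =>
      (Complex.norm_exp_ofReal_mul_I _).le)
    exact (by fun_prop : Continuous fun ξ : EuclideanSpace ℝ (Fin d) =>
      Complex.exp ((2 * Real.pi * inner ℝ ξ x : ℝ) * Complex.I)).aestronglyMeasurable
  have hinner : ∀ n, ‖∑ j, star (e j) * 𝓕⁻ (fun ξ => (m ξ : ℂ) * v n ξ j) x‖ =
      ‖(inner ℂ (v n) hk.toLp : ℂ)‖ := by
    intro n
    rw [norm_inner_symm, L2.inner_def]
    congr 1
    simp_rw [Real.fourierInv_eq', smul_eq_mul, ← integral_const_mul]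
    rw [← integral_finsetSum _ fun j _ => hint n j]
    refine integral_congr_ae ?_
    filter_upwards [hk.coeFn_toLp] with ξ hξ
    rw [hξ, inner_smul_left, PiLp.inner_apply e, Finset.mul_sum]
    refine Finset.sum_congr rfl fun j _ => ?_
    simp only [hc, RCLike.inner_apply, map_mul, Complex.conj_ofReal, Complex.star_def,
      Complex.conj_conj]
    ring
  simp_rw [hinner]
  refine (hv.sum_inner_products_le _).trans_eq ?_
  rw [norm_sq_eq_integral, ← integral_mul_const]
  refine integral_congr_ae ?_
  filter_upwards [hk.coeFn_toLp] with ξ hξ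
  rw [hξ, norm_smul, hcn, mul_pow, Real.norm_eq_abs, sq_abs]

/-! ### Optimization over the energy scale μ -/

section Optimization

/-- Insert the minimizer of the right-hand side. It is applied with a = (W M_e)^{1/2} and b =
C^{1/2}. -/
theorem rpow_le_of_forall_le_add {d s a b : ℝ} (hd : 0 < d) (hs : 0 ≤ s) (ha : 0 ≤ a) (hb : 0 < b)
    (h : ∀ μ : ℝ, 0 < μ → s ≤ a * μ ^ (-(1 / 2) : ℝ) + b * μ ^ (d / 4)) :
    s ^ (2 + 4 / d) ≤
      a ^ 2 * b ^ (4 / d) * (((d + 2) / d) ^ (2 + 4 / d) * (d / 2) ^ (4 / d)) := by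
  rcases ha.eq_or_lt with rfl | ha
  · rcases hs.eq_or_lt with rfl | hs
    · rw [Real.zero_rpow (by positivity)]
      positivity
    · exfalso
      -- Without the first term no minimizer exists; this μ makes the second term equal s/2.
      have h1 := h ((s / (2 * b)) ^ (4 / d)) (by positivity)
      rw [← Real.rpow_mul (x := s / (2 * b)) (by positivity), ← Real.rpow_mul (by positivity),
        show 4 / d * (d / 4) = 1 by field_simp, Real.rpow_one] at h1
      have h2 : b * (s / (2 * b)) = s / 2 := by field_simp
      linarith
  -- The critical point satisfies μ^{(d+2)/4} = y.
  · set y : ℝ := 2 * a / (d * b) with hy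
    have hy0 : 0 < y := by positivity
    have h1 := h (y ^ (4 / (d + 2))) (by positivity)
    rw [← Real.rpow_mul hy0.le, ← Real.rpow_mul hy0.le,
      show 4 / (d + 2) * -(1 / 2) = -(2 / (d + 2)) by ring,
      show 4 / (d + 2) * (d / 4) = 1 + -(2 / (d + 2)) by field_simp; ring,
      Real.rpow_add hy0, Real.rpow_one] at h1
    have h2 : s ≤ y ^ (-(2 / (d + 2))) * (a * ((d + 2) / d)) := by
      refine h1.trans_eq ?_
      have : b * y = 2 * a / d := by rw [hy]; field_simp
      rw [← mul_assoc b, this]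
      field_simp
    calc s ^ (2 + 4 / d) ≤ (y ^ (-(2 / (d + 2))) * (a * ((d + 2) / d))) ^ (2 + 4 / d) := by gcongr
      _ = y ^ (-(4 / d)) * (a ^ (2 + 4 / d) * ((d + 2) / d) ^ (2 + 4 / d)) := by
          rw [Real.mul_rpow (by positivity) (by positivity),
            Real.mul_rpow (by positivity) (by positivity), ← Real.rpow_mul hy0.le]
          congr 2
          field_simp
          ring
      _ = _ := by
          rw [Real.rpow_neg hy0.le, ← Real.inv_rpow hy0.le, Real.rpow_add ha]
          have h3 : y⁻¹ ^ (4 / d) * a ^ (4 / d) = b ^ (4 / d) * (d / 2) ^ (4 / d) := by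
            rw [← Real.mul_rpow (by positivity) (by positivity),
              ← Real.mul_rpow (by positivity) (by positivity)]
            congr 1
            rw [hy]
            field_simp
          have h4 : a ^ (2 : ℝ) = a ^ 2 := by norm_cast
          rw [h4]
          linear_combination a ^ 2 * ((d + 2) / d) ^ (2 + 4 / d) * h3

/-- Continuity in μ lets one null set, collected over countably many μ, serve for all of them. -/
theorem forall_le_of_forall_rat_le {d s a b : ℝ}
    (h : ∀ μ : ℚ, 0 < μ → s ≤ a * (μ : ℝ) ^ (-(1 / 2) : ℝ) + b * (μ : ℝ) ^ (d / 4)) (μ : ℝ)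
    (hμ : 0 < μ) : s ≤ a * μ ^ (-(1 / 2) : ℝ) + b * μ ^ (d / 4) := by
  obtain ⟨r, -, hr, ht⟩ := Real.exists_seq_rat_strictAnti_tendsto μ
  have hc : ContinuousAt (fun y : ℝ => a * y ^ (-(1 / 2) : ℝ) + b * y ^ (d / 4)) μ :=
    ((Real.continuousAt_rpow_const _ _ (.inl hμ.ne')).const_mul a).add
      ((Real.continuousAt_rpow_const _ _ (.inl hμ.ne')).const_mul b)
  exact ge_of_tendsto' (hc.tendsto.comp ht) fun k => h (r k) (by exact_mod_cast hμ.trans (hr k))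

theorem sqrt_sum_norm_sq_add_le {N : ℕ} (a b : Fin N → ℂ) :
    √(∑ n, ‖a n + b n‖ ^ 2) ≤ √(∑ n, ‖a n‖ ^ 2) + √(∑ n, ‖b n‖ ^ 2) := by
  simpa [EuclideanSpace.norm_eq] using
    norm_add_le (WithLp.toLp 2 a : EuclideanSpace ℂ (Fin N)) (WithLp.toLp 2 b)

/-- Minkowski's inequality in ℂ^N separates average and remainder; Cauchy–Schwarz against ω bounds
the average. -/
theorem sqrt_le_add_of_decomposition {H : Type*} [NormedAddCommGroup H] [InnerProductSpace ℂ H]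
    {N q : ℕ} {v : Fin N → EuclideanSpace ℂ (Fin q)} {U : Fin N → Fin q → H}
    {B : Fin N → Fin q → ℂ} {ω : H} {W C μ d : ℝ} (hW : 0 ≤ W) (hC : 0 ≤ C) (hμ : 0 < μ)
    (hω : ‖ω‖ ^ 2 = W / μ) (hdec : ∀ n j, v n j = inner ℂ ω (U n j) + B n j)
    {e : EuclideanSpace ℂ (Fin q)}
    (hB : ∑ n, ‖∑ j, star (e j) * B n j‖ ^ 2 ≤ C * μ ^ (d / 2)) :
    √(∑ n, ‖∑ j, star (e j) * v n j‖ ^ 2) ≤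
      √(W * ∑ n, ‖∑ j, star (e j) • U n j‖ ^ 2) * μ ^ (-(1 / 2) : ℝ) + √C * μ ^ (d / 4) := by
  have h1 : ∀ n, ∑ j, star (e j) * v n j =
      inner ℂ ω (∑ j, star (e j) • U n j) + ∑ j, star (e j) * B n j := by
    intro n
    simp_rw [hdec, mul_add, Finset.sum_add_distrib, inner_sum, inner_smul_right]
  simp_rw [h1]
  refine (sqrt_sum_norm_sq_add_le _ _).trans (add_le_add ?_ ?_)
  · rw [Real.rpow_neg hμ.le, ← Real.sqrt_eq_rpow, ← Real.sqrt_inv,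
      ← Real.sqrt_mul (mul_nonneg hW (Finset.sum_nonneg fun n _ => sq_nonneg _))]
    refine Real.sqrt_le_sqrt ?_
    have h2 : W * (∑ n, ‖∑ j, star (e j) • U n j‖ ^ 2) * μ⁻¹ =
        ∑ n, ‖ω‖ ^ 2 * ‖∑ j, star (e j) • U n j‖ ^ 2 := by
      rw [← Finset.mul_sum, hω]
      ring
    rw [h2]
    refine Finset.sum_le_sum fun n _ => ?_
    rw [← mul_pow]
    gcongr
    exact norm_inner_le_norm _ _
  · rw [show d / 4 = d / 2 * (1 / 2) by ring, Real.rpow_mul hμ.le, ← Real.sqrt_eq_rpow,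
      ← Real.sqrt_mul hC]
    exact Real.sqrt_le_sqrt hB

end Optimization

/-! ### Spectral form of the pointwise matrix inequality -/

section Matrices

/-- Unitary invariance of the Hilbert–Schmidt norm: bounds summed over an x-dependent eigenbasis
give a basis-free total. -/
theorem sum_norm_sq_orthonormalBasis {H : Type*} [NormedAddCommGroup H] [InnerProductSpace ℂ H]
    {q : ℕ} (b : OrthonormalBasis (Fin q) ℂ (EuclideanSpace ℂ (Fin q))) (U : Fin q → H) :
    ∑ i, ‖∑ j, star (b i j) • U j‖ ^ 2 = ∑ j, ‖U j‖ ^ 2 := by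
  have hb : ∀ j k, ∑ i, b i j * star (b i k) = if j = k then 1 else 0 := by
    intro j k
    have := b.sum_inner_mul_inner (EuclideanSpace.single j 1) (EuclideanSpace.single k 1)
    simpa [EuclideanSpace.inner_single_left, EuclideanSpace.inner_single_right, Pi.single_apply,
      eq_comm] using this
  have h : ∑ i, (inner ℂ (∑ j, star (b i j) • U j) (∑ j, star (b i j) • U j) : ℂ) =
      ∑ j, inner ℂ (U j) (U j) := by
    simp_rw [sum_inner, inner_sum, inner_smul_left, inner_smul_right]
    rw [Finset.sum_comm]
    refine Finset.sum_congr rfl fun j _ => ?_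
    rw [Finset.sum_comm]
    have : ∀ k, ∑ i, (starRingEnd ℂ) (star (b i j)) * (star (b i k) * inner ℂ (U j) (U k)) =
        (if j = k then 1 else 0) * inner ℂ (U j) (U k) := by
      intro k
      rw [← hb, Finset.sum_mul]
      refine Finset.sum_congr rfl fun i _ => ?_
      rw [starRingEnd_apply, star_star, mul_assoc]
    rw [Finset.sum_congr rfl fun k _ => this k]
    simp
  simp_rw [inner_self_eq_norm_sq_to_K] at h
  exact_mod_cast h

/-- `∑ₙ vₙ vₙ^*` for vectors `v₁, …, v_N` of `ℂ^q`. -/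
def outerSum {q N : ℕ} (v : Fin N → EuclideanSpace ℂ (Fin q)) : Matrix (Fin q) (Fin q) ℂ :=
  ∑ n, Matrix.vecMulVec (⇑(v n)) (star (⇑(v n)))

theorem isHermitian_outerSum {q N : ℕ} (v : Fin N → EuclideanSpace ℂ (Fin q)) :
    (outerSum v).IsHermitian := by
  rw [Matrix.IsHermitian, outerSum, Matrix.conjTranspose_sum]
  refine Finset.sum_congr rfl fun n _ => ?_
  rw [Matrix.conjTranspose_vecMulVec, star_star]

theorem eigenvalues_outerSum {q N : ℕ} (v : Fin N → EuclideanSpace ℂ (Fin q)) (i : Fin q) :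
    (isHermitian_outerSum v).eigenvalues i =
      ∑ n, ‖∑ j, star ((isHermitian_outerSum v).eigenvectorBasis i j) * v n j‖ ^ 2 := by
  rw [Matrix.IsHermitian.eigenvalues_eq]
  generalize (isHermitian_outerSum v).eigenvectorBasis i = e
  rw [outerSum, Matrix.sum_mulVec, dotProduct_sum, map_sum]
  refine Finset.sum_congr rfl fun n _ => ?_
  rw [Matrix.vecMulVec_mulVec]
  have h1 : star (⇑(v n)) ⬝ᵥ ⇑e = star (∑ j, star (e j) * v n j) := by
    simp [dotProduct, mul_comm]
  have h2 : star (⇑e) ⬝ᵥ ⇑(v n) = ∑ j, star (e j) * v n j := by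
    simp [dotProduct]
  rw [h1, dotProduct_smul, h2]
  generalize ∑ j, star (e j) * v n j = z
  rw [op_smul_eq_mul, Complex.star_def, Complex.mul_conj, Complex.normSq_eq_norm_sq]
  exact Complex.ofReal_re _

theorem tracePow_eq_sum {q : ℕ} {A : Matrix (Fin q) (Fin q) ℂ} (hA : A.IsHermitian) (p : ℝ) :
    tracePow A p = ∑ i, hA.eigenvalues i ^ p := by
  rw [tracePow, hA.cfc_eq, Matrix.IsHermitian.cfc, Unitary.conjStarAlgAut_apply,
    Matrix.trace_mul_cycle]
  simp [Matrix.trace]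

open scoped Matrix.Norms.L2Operator in
-- Continuity of the functional calculus gives measurability of Tr R(x)^p without a measurable
-- choice of eigenvalues.
theorem continuous_tracePow_outerSum {q N : ℕ} {p : ℝ} (hp : 0 ≤ p) :
    Continuous fun v : Fin N → EuclideanSpace ℂ (Fin q) => tracePow (outerSum v) p := by
  have h1 : Continuous fun v : Fin N → EuclideanSpace ℂ (Fin q) => outerSum v := by
    refine continuous_finsetSum _ fun n _ => continuous_matrix fun i j => ?_
    simp only [Matrix.vecMulVec_apply, Pi.star_apply]
    fun_prop
  have h2 : Continuous fun v : Fin N → EuclideanSpace ℂ (Fin q) =>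
      cfc (fun t : ℝ => t ^ p) (outerSum v) :=
    Continuous.cfc_of_mem_nhdsSet (s := univ) _ Filter.univ_mem h1
      (fun v => (isHermitian_outerSum v).isSelfAdjoint)
      (Real.continuous_rpow_const hp).continuousOn
  exact Complex.continuous_re.comp h2.matrix_trace

theorem sqrt_rpow {r d : ℝ} (hr : 0 ≤ r) : √r ^ (2 + 4 / d) = r ^ (1 + 2 / d) := by
  rw [Real.sqrt_eq_rpow, ← Real.rpow_mul hr]
  congr 1
  ring

/-- The pointwise matrix inequality `Tr R^{1+2/d} ≤ const · Tr M`. -/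
theorem tracePow_outerSum_le {H : Type*} [NormedAddCommGroup H] [InnerProductSpace ℂ H]
    {N q : ℕ} {v : Fin N → EuclideanSpace ℂ (Fin q)} {U : Fin N → Fin q → H}
    {W C d : ℝ} (hd : 0 < d) (hW : 0 ≤ W) (hC : 0 < C)
    (h : ∀ μ : ℚ, 0 < μ → ∃ (ω : H) (B : Fin N → Fin q → ℂ), ‖ω‖ ^ 2 = W / (μ : ℝ) ∧
      (∀ n j, v n j = inner ℂ ω (U n j) + B n j) ∧
      ∀ e : EuclideanSpace ℂ (Fin q), ∑ n, ‖∑ j, star (e j) * B n j‖ ^ 2 ≤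
        C * (μ : ℝ) ^ (d / 2) * ‖e‖ ^ 2) :
    tracePow (outerSum v) (1 + 2 / d) ≤
      W * C ^ (2 / d) * (((d + 2) / d) ^ (2 + 4 / d) * (d / 2) ^ (4 / d)) *
        ∑ n, ∑ j, ‖U n j‖ ^ 2 := by
  have hA := isHermitian_outerSum v
  rw [tracePow_eq_sum hA]
  simp_rw [← sum_norm_sq_orthonormalBasis hA.eigenvectorBasis (U _)]
  rw [Finset.sum_comm, Finset.mul_sum]
  -- From here the problem is scalar, one eigenvector at a time, each with its own optimal μ.
  refine Finset.sum_le_sum fun i _ => ?_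
  rw [eigenvalues_outerSum]
  have he : ‖hA.eigenvectorBasis i‖ = 1 := hA.eigenvectorBasis.norm_eq_one i
  generalize hA.eigenvectorBasis i = e at he
  have hm : 0 ≤ ∑ n, ‖∑ j, star (e j) • U n j‖ ^ 2 := Finset.sum_nonneg fun n _ => sq_nonneg _
  rw [← sqrt_rpow (Finset.sum_nonneg fun n _ => sq_nonneg _)]
  refine (rpow_le_of_forall_le_add hd (Real.sqrt_nonneg _)
    (Real.sqrt_nonneg (W * ∑ n, ‖∑ j, star (e j) • U n j‖ ^ 2))
    (Real.sqrt_pos.2 hC) (forall_le_of_forall_rat_le fun μ hμ => ?_)).trans_eq ?_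
  · obtain ⟨ω, B, hω, hdec, hB⟩ := h μ hμ
    refine sqrt_le_add_of_decomposition hW hC.le (by exact_mod_cast hμ) hω hdec ?_
    simpa [he] using hB e
  · rw [Real.sq_sqrt (mul_nonneg hW hm), Real.sqrt_eq_rpow, ← Real.rpow_mul hC.le,
      show 1 / 2 * (4 / d) = 2 / d by ring]
    ring

end Matrices

/-! ### Kinetic energy in momentum space -/

section Kinetic

variable {d q : ℕ} {u : L2 d q}

theorem sum_norm_sq_fourier_weakPartial (hu : MemH1 u) :
    ∀ᵐ ξ, ∑ i, ‖(𝓕 (weakPartial hu i) : L2 d q) ξ‖ ^ 2 =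
      (2 * Real.pi * ‖ξ‖) ^ 2 * ‖(𝓕 u : L2 d q) ξ‖ ^ 2 := by
  filter_upwards [ae_all_iff.2 fun i => fourier_weakPartial hu i] with ξ h
  simp_rw [h, norm_smul, mul_pow, ← Finset.sum_mul, EuclideanSpace.norm_sq_eq ξ]
  simp [abs_of_pos Real.pi_pos, ← Finset.mul_sum, mul_pow]

theorem integrable_norm_sq (φ : L2 d q) : Integrable fun x => ‖φ x‖ ^ 2 :=
  (memLp_two_iff_integrable_sq_norm (Lp.aestronglyMeasurable φ)).1 (Lp.memLp φ)

theorem integrable_momentum_sq (hu : MemH1 u) :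
    Integrable fun ξ => (2 * Real.pi * ‖ξ‖) ^ 2 * ‖(𝓕 u : L2 d q) ξ‖ ^ 2 :=
  (integrable_finsetSum _ fun i _ => integrable_norm_sq (𝓕 (weakPartial hu i) : L2 d q)).congr
    (sum_norm_sq_fourier_weakPartial hu)

theorem gradSqIntegral_eq (hu : MemH1 u) :
    gradSqIntegral hu = ∫ ξ, (2 * Real.pi * ‖ξ‖) ^ 2 * ‖(𝓕 u : L2 d q) ξ‖ ^ 2 := by
  rw [gradSqIntegral, ← integral_congr_ae (sum_norm_sq_fourier_weakPartial hu),
    integral_finsetSum _ fun i _ => integrable_norm_sq _,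
    integral_finsetSum _ fun i _ => integrable_norm_sq _]
  refine Finset.sum_congr rfl fun i _ => ?_
  rw [← norm_sq_eq_integral, ← norm_sq_eq_integral, Lp.norm_fourier_eq]

/-- The `j`-th component of a `ℂ^q`-valued `L²` function. -/
noncomputable def component (φ : L2 d q) (j : Fin q) :
    Lp ℂ 2 (volume : Measure (EuclideanSpace ℝ (Fin d))) :=
  (EuclideanSpace.proj (𝕜 := ℂ) j).compLp φ

theorem component_coeFn (φ : L2 d q) (j : Fin q) : ∀ᵐ x, component φ j x = φ x j :=
  (EuclideanSpace.proj (𝕜 := ℂ) j).coeFn_compLp φ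

theorem memLp_momentum_component (hu : MemH1 u) (j : Fin q) :
    MemLp (fun ξ => (‖ξ‖ : ℂ) * component (𝓕 u : L2 d q) j ξ) 2 := by
  have hm : AEStronglyMeasurable fun ξ => (‖ξ‖ : ℂ) * component (𝓕 u : L2 d q) j ξ :=
    (Continuous.aestronglyMeasurable (by fun_prop)).mul (Lp.aestronglyMeasurable _)
  rw [memLp_two_iff_integrable_sq_norm hm]
  refine (integrable_momentum_sq hu).mono' (hm.norm.pow 2) ?_
  filter_upwards [component_coeFn (𝓕 u : L2 d q) j] with ξ h
  rw [h, Real.norm_of_nonneg (by positivity), norm_mul, Complex.norm_real, norm_norm, mul_pow]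
  have h1 : ‖(𝓕 u : L2 d q) ξ j‖ ≤ ‖(𝓕 u : L2 d q) ξ‖ := PiLp.norm_apply_le _ j
  have h2 : ‖ξ‖ ≤ 2 * Real.pi * ‖ξ‖ :=
    le_mul_of_one_le_left (norm_nonneg _) (by linarith [Real.pi_gt_three])
  gcongr

theorem sum_integral_component (hu : MemH1 u) :
    ∑ j, ∫ ξ, (2 * Real.pi * ‖ξ‖) ^ 2 * ‖component (𝓕 u : L2 d q) j ξ‖ ^ 2 =
      gradSqIntegral hu := by
  rw [gradSqIntegral_eq, ← integral_finsetSum]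
  · refine integral_congr_ae ?_
    filter_upwards [ae_all_iff.2 fun j => component_coeFn (𝓕 u : L2 d q) j] with ξ h
    simp_rw [h, ← Finset.mul_sum, EuclideanSpace.norm_sq_eq]
  · intro j _
    have h := (memLp_two_iff_integrable_sq_norm (memLp_momentum_component hu j).1).1
      (memLp_momentum_component hu j)
    refine (h.const_mul ((2 * Real.pi) ^ 2)).congr (.of_forall fun ξ => ?_)
    simp only [norm_mul, Complex.norm_real, norm_norm]
    ring

theorem fourierInv_component_fourier (u : L2 d q) (j : Fin q) :
    (𝓕⁻ (component (𝓕 u : L2 d q) j) : Lp ℂ 2 (volume : Measure (EuclideanSpace ℝ (Fin d)))) =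
      component u j := by
  rw [component, fourierInv_compLp, FourierPair.fourierInv_fourier_eq, component]

end Kinetic

/-! ### Bookkeeping of the constants -/

section Constants

/-- The constant `K̃_d` with the value `c` of a competitor in place of `𝓘_d`. -/
noncomputable def kineticConst (d : ℕ) (c : ℝ) : ℝ :=
  (2 : ℝ) ^ (6 / (d : ℝ)) * (d : ℝ) ^ 2 * (2 * Real.pi) ^ 2 /
      (((d : ℝ) + 2) ^ (2 + 4 / (d : ℝ)) * sphereArea d ^ (2 / (d : ℝ))) *
    c ^ (-(2 / (d : ℝ)))

theorem ballVolume_pos (d : ℕ) : 0 < ballVolume d :=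
  ENNReal.toReal_pos (Metric.measure_ball_pos _ _ one_pos).ne' measure_ball_lt_top.ne

theorem sphereArea_eq (d : ℕ) : sphereArea d = d * ballVolume d := by
  rw [sphereArea, Measure.toSphere_real_apply_univ, finrank_euclideanSpace, Fintype.card_fin,
    ballVolume]

theorem sphereArea_pos {d : ℕ} (hd : 1 ≤ d) : 0 < sphereArea d := by
  rw [sphereArea_eq]
  exact mul_pos (by exact_mod_cast hd) (ballVolume_pos d)

/-- The kinetic constant is the reciprocal of the pointwise constant in `tracePow_outerSum_le`, with
C the coefficient of μ^{d/2} in `norm_sq_defectSymbol`. The factor 2^{6/d} collects 2^{2/d} from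
C^{2/d} and 2^{4/d} from (d/2)^{4/d}. -/
theorem kineticConst_mul {d : ℕ} (hd : 1 ≤ d) {W D : ℝ} (hW : 0 < W) (hD : 0 < D) :
    kineticConst d (W ^ ((d : ℝ) / 2) * D) *
      (W * (sphereArea d * D / (2 * (2 * Real.pi) ^ d)) ^ (2 / (d : ℝ)) *
        ((((d : ℝ) + 2) / d) ^ (2 + 4 / (d : ℝ)) * ((d : ℝ) / 2) ^ (4 / (d : ℝ)))) = 1 := by
  have hd0 : (0 : ℝ) < d := by exact_mod_cast hd
  have hS := sphereArea_pos hd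
  have hπ := Real.pi_pos
  have h1 : (W ^ ((d : ℝ) / 2) * D) ^ (-(2 / (d : ℝ))) = (W * D ^ (2 / (d : ℝ)))⁻¹ := by
    rw [Real.rpow_neg (by positivity), Real.mul_rpow (by positivity) hD.le, ← Real.rpow_mul hW.le,
      show (d : ℝ) / 2 * (2 / d) = 1 by field_simp, Real.rpow_one]
  have h2 : (sphereArea d * D / (2 * (2 * Real.pi) ^ d)) ^ (2 / (d : ℝ)) =
      sphereArea d ^ (2 / (d : ℝ)) * D ^ (2 / (d : ℝ)) /
        ((2 : ℝ) ^ (2 / (d : ℝ)) * (2 * Real.pi) ^ 2) := by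
    rw [Real.div_rpow (by positivity) (by positivity), Real.mul_rpow hS.le hD.le,
      Real.mul_rpow (by norm_num) (by positivity), ← Real.rpow_natCast (2 * Real.pi) d,
      ← Real.rpow_mul (by positivity), show (d : ℝ) * (2 / d) = 2 by field_simp]
    norm_cast
  have h3 : (((d : ℝ) + 2) / d) ^ (2 + 4 / (d : ℝ)) =
      ((d : ℝ) + 2) ^ (2 + 4 / (d : ℝ)) / ((d : ℝ) ^ 2 * (d : ℝ) ^ (4 / (d : ℝ))) := by
    rw [Real.div_rpow (by positivity) hd0.le, Real.rpow_add hd0]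
    norm_cast
  have h4 : ((d : ℝ) / 2) ^ (4 / (d : ℝ)) = (d : ℝ) ^ (4 / (d : ℝ)) / (2 : ℝ) ^ (4 / (d : ℝ)) :=
    Real.div_rpow hd0.le (by norm_num) _
  have h5 : (2 : ℝ) ^ (6 / (d : ℝ)) = (2 : ℝ) ^ (2 / (d : ℝ)) * (2 : ℝ) ^ (4 / (d : ℝ)) := by
    rw [← Real.rpow_add (by norm_num)]
    congr 1
    ring
  rw [kineticConst, h1, h2, h3, h4, h5]
  have p1 : 0 < (2 : ℝ) ^ (2 / (d : ℝ)) := by positivity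
  have p2 : 0 < (2 : ℝ) ^ (4 / (d : ℝ)) := by positivity
  have p3 : 0 < (d : ℝ) ^ (4 / (d : ℝ)) := by positivity
  have p4 : 0 < ((d : ℝ) + 2) ^ (2 + 4 / (d : ℝ)) := by positivity
  have p5 : 0 < sphereArea d ^ (2 / (d : ℝ)) := by positivity
  have p6 : 0 < D ^ (2 / (d : ℝ)) := by positivity
  field_simp

theorem Ktilde_eq_mul_Kcl {d : ℕ} (hd : 1 ≤ d) :
    Ktilde d = (2 : ℝ) ^ (6 / (d : ℝ)) * (d : ℝ) ^ (1 - 2 / (d : ℝ)) /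
        ((d : ℝ) + 2) ^ (1 + 4 / (d : ℝ)) * varI d ^ (-(2 / (d : ℝ))) * Kcl d := by
  have hd0 : (0 : ℝ) < d := by exact_mod_cast hd
  have hB := ballVolume_pos d
  have h1 : ((d : ℝ) + 2) ^ (2 + 4 / (d : ℝ)) = ((d : ℝ) + 2) ^ (1 + 4 / (d : ℝ)) * (d + 2) := by
    rw [← Real.rpow_add_one (by positivity)]
    congr 1
    ring
  have h2 : (d : ℝ) ^ (1 - 2 / (d : ℝ)) = d / (d : ℝ) ^ (2 / (d : ℝ)) := by
    rw [Real.rpow_sub hd0, Real.rpow_one]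
  rw [Ktilde, Kcl, sphereArea_eq, Real.mul_rpow hd0.le hB.le, h1, h2]
  have p1 : 0 < (d : ℝ) ^ (2 / (d : ℝ)) := by positivity
  have p2 : 0 < ((d : ℝ) + 2) ^ (1 + 4 / (d : ℝ)) := by positivity
  have p3 : 0 < ballVolume d ^ (2 / (d : ℝ)) := by positivity
  field_simp

end Constants

/-! ### The kinetic inequality and passage to the infimum -/

section Inequality

variable {d q N : ℕ} {f w : ℝ → ℝ}

theorem Admissible.gDefect_pos (hd : 1 ≤ d) (h : Admissible d f w) : 0 < gDefect d f w := by
  have hd0 : (0 : ℝ) < d := by exact_mod_cast hd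
  have hW := h.integral_w_sq_pos
  have h1 := lt_of_lt_of_le (by positivity : 0 < (4 : ℝ) ^ (-((d : ℝ) / 2)) / (2 * d))
    (h.le_value hd)
  exact pos_of_mul_pos_right h1 (by positivity)

theorem densityMatrix_eq (u : Fin N → L2 d q) (x : EuclideanSpace ℝ (Fin d)) :
    densityMatrix u x = outerSum fun n => u n x := rfl

theorem aestronglyMeasurable_tracePow (u : Fin N → L2 d q) {p : ℝ} (hp : 0 ≤ p) :
    AEStronglyMeasurable fun x => tracePow (densityMatrix u x) p := by
  refine (continuous_tracePow_outerSum (q := q) (N := N) hp).comp_aestronglyMeasurable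
    (f := fun x n => u n x) ?_
  exact (aemeasurable_pi_lambda _ fun n =>
    (Lp.aestronglyMeasurable (u n)).aemeasurable).aestronglyMeasurable

theorem tracePow_nonneg (u : Fin N → L2 d q) (p : ℝ) (x : EuclideanSpace ℝ (Fin d)) :
    0 ≤ tracePow (densityMatrix u x) p := by
  rw [densityMatrix_eq, tracePow_eq_sum (isHermitian_outerSum _)]
  refine Finset.sum_nonneg fun i _ => Real.rpow_nonneg ?_ _
  rw [eigenvalues_outerSum]
  exact Finset.sum_nonneg fun n _ => sq_nonneg _

/-- The kinetic energy density in momentum and energy space, as an `L²` function of position with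
values in `L²(d log E)`. -/
noncomputable def energyWave (hf : MemLp f 2 (volume.restrict (Ioi (0 : ℝ)))) {u : L2 d q}
    (hu : MemH1 u) (j : Fin q) :
    Lp (Lp ℂ 2 (volume : Measure ℝ)) 2 (volume : Measure (EuclideanSpace ℝ (Fin d))) :=
  𝓕⁻ (energyLift hf (component (𝓕 u : L2 d q) j) (memLp_momentum_component hu j))

/-- Plancherel in x combined with the layer identity in E. -/
theorem Admissible.sum_norm_sq_energyWave (h : Admissible d f w) {u : L2 d q} (hu : MemH1 u) :
    ∑ j, ‖energyWave h.f_memLp hu j‖ ^ 2 = gradSqIntegral hu := by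
  rw [← sum_integral_component]
  refine Finset.sum_congr rfl fun j _ => ?_
  rw [← norm_sq_energyLift h.f_memLp _ (memLp_momentum_component hu j) h.norm_logLp_f, energyWave]
  congr 1
  exact (Lp.fourierTransformₗᵢ _ _).symm.norm_map _

theorem Admissible.tracePow_le (hd : 1 ≤ d) (h : Admissible d f w) {u : Fin N → L2 d q}
    (hu : ∀ n, MemH1 (u n)) (hortho : Orthonormal ℂ u) :
    ∀ᵐ x, kineticConst d ((∫ s in Ioi (0 : ℝ), w s ^ 2) ^ ((d : ℝ) / 2) * gDefect d f w) *
      tracePow (densityMatrix u x) (1 + 2 / (d : ℝ)) ≤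
        ∑ n, ∑ j, ‖energyWave h.f_memLp (hu n) j x‖ ^ 2 := by
  have hd0 : (0 : ℝ) < d := by exact_mod_cast hd
  have hD := h.gDefect_pos hd
  have hW := h.integral_w_sq_pos
  have hS := sphereArea_pos hd
  have hv : Orthonormal ℂ fun n => (𝓕 (u n) : L2 d q) :=
    hortho.comp_linearIsometryEquiv (Lp.fourierTransformₗᵢ _ _)
  -- One null set for all n, j and rational μ; no direction e enters, so e may later depend on x.
  have hdec : ∀ᵐ x, ∀ (n : Fin N) (j : Fin q) (μ : ℚ), 0 < μ → component (u n) j x =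
      inner ℂ (weightVec h.w_memLp μ) (energyWave h.f_memLp (hu n) j x) +
        𝓕⁻ (fun ξ => (defectSymbol f w μ ξ : ℂ) * component (𝓕 (u n) : L2 d q) j ξ) x := by
    simp_rw [ae_all_iff]
    intro n j μ hμ
    rw [← fourierInv_component_fourier]
    exact fourierInv_decomposition hd h (by exact_mod_cast hμ) _ _
  filter_upwards [hdec, ae_all_iff.2 fun n => ae_all_iff.2 fun j => component_coeFn (u n) j]
    with x hx hc
  have hC : 0 < sphereArea d * gDefect d f w / (2 * (2 * Real.pi) ^ d) := by positivity
  have key := tracePow_outerSum_le (v := fun n => u n x)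
    (U := fun n j => energyWave h.f_memLp (hu n) j x) hd0 hW.le hC fun μ hμ => by
      have hμ0 : (0 : ℝ) < μ := by exact_mod_cast hμ
      refine ⟨weightVec h.w_memLp μ, fun n j => 𝓕⁻ (fun ξ => (defectSymbol f w μ ξ : ℂ) *
        component (𝓕 (u n) : L2 d q) j ξ) x, norm_sq_weightVec h.w_memLp hμ0, fun n j => ?_,
        fun e => ?_⟩
      · rw [← hc n j, hx n j μ hμ]
      · obtain ⟨h1, h2⟩ := norm_sq_defectSymbol hd h hμ0
        rw [← h2]
        -- Replacing component representatives changes the integrand only on a null set of ξ, so the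
        -- Fourier integrals agree at every x.
        refine le_trans (le_of_eq ?_) (sum_norm_sq_fourierInv_le hv h1 e x)
        refine Finset.sum_congr rfl fun n _ => ?_
        congr 2
        refine Finset.sum_congr rfl fun j _ => ?_
        beta_reduce
        rw [Real.fourierInv_eq, Real.fourierInv_eq]
        congr 1
        refine integral_congr_ae ?_
        filter_upwards [component_coeFn (𝓕 (u n) : L2 d q) j] with ξ hξ
        rw [hξ]
  have hk : 0 ≤ kineticConst d
      ((∫ s in Ioi (0 : ℝ), w s ^ 2) ^ ((d : ℝ) / 2) * gDefect d f w) := by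
    unfold kineticConst
    positivity
  refine (mul_le_mul_of_nonneg_left key hk).trans_eq ?_
  rw [← mul_assoc, kineticConst_mul hd hW hD, one_mul]

/-- The kinetic inequality with the constant of one competitor. -/
theorem Admissible.kinetic_inequality (hd : 1 ≤ d) (h : Admissible d f w) {u : Fin N → L2 d q}
    (hu : ∀ n, MemH1 (u n)) (hortho : Orthonormal ℂ u) :
    Integrable (fun x => tracePow (densityMatrix u x) (1 + 2 / (d : ℝ))) ∧
    kineticConst d ((∫ s in Ioi (0 : ℝ), w s ^ 2) ^ ((d : ℝ) / 2) * gDefect d f w) *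
      ∫ x, tracePow (densityMatrix u x) (1 + 2 / (d : ℝ)) ≤ ∑ n, gradSqIntegral (hu n) := by
  have hd0 : (0 : ℝ) < d := by exact_mod_cast hd
  have hD := h.gDefect_pos hd
  have hW := h.integral_w_sq_pos
  have hS := sphereArea_pos hd
  set K := kineticConst d ((∫ s in Ioi (0 : ℝ), w s ^ 2) ^ ((d : ℝ) / 2) * gDefect d f w)
    with hK
  have hK0 : 0 < K := by
    rw [hK, kineticConst]
    positivity
  have hi : ∀ n j, Integrable fun x => ‖energyWave h.f_memLp (hu n) j x‖ ^ 2 := fun n j =>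
    (memLp_two_iff_integrable_sq_norm (Lp.aestronglyMeasurable _)).1 (Lp.memLp _)
  have hsum : Integrable fun x => ∑ n, ∑ j, ‖energyWave h.f_memLp (hu n) j x‖ ^ 2 :=
    integrable_finsetSum _ fun n _ => integrable_finsetSum _ fun j _ => hi n j
  have hle := h.tracePow_le hd hu hortho
  have hint : Integrable (fun x => K * tracePow (densityMatrix u x) (1 + 2 / (d : ℝ))) := by
    refine hsum.mono' ((aestronglyMeasurable_tracePow u (by positivity)).const_mul K) ?_
    filter_upwards [hle] with x hx
    rwa [Real.norm_of_nonneg (mul_nonneg hK0.le (tracePow_nonneg u _ x))]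
  refine ⟨(integrable_const_mul_iff hK0.ne'.isUnit _).1 hint, ?_⟩
  rw [← integral_const_mul]
  refine (integral_mono_ae hint hsum hle).trans_eq ?_
  rw [integral_finsetSum _ fun n _ => integrable_finsetSum _ fun j _ => hi n j]
  refine Finset.sum_congr rfl fun n _ => ?_
  rw [integral_finsetSum _ fun j _ => hi n j, ← h.sum_norm_sq_energyWave (hu n)]
  exact Finset.sum_congr rfl fun j _ => (norm_sq_eq_integral _).symm

theorem Ktilde_mul_le (hd : 1 ≤ d) {u : Fin N → L2 d q}
    (hu : ∀ n, MemH1 (u n)) (hortho : Orthonormal ℂ u) :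
    Ktilde d * ∫ x, tracePow (densityMatrix u x) (1 + 2 / (d : ℝ)) ≤
      ∑ n, gradSqIntegral (hu n) := by
  obtain ⟨f₀, w₀, h₀⟩ := exists_admissible d hd
  set S := {c : ℝ | ∃ f w : ℝ → ℝ, Admissible d f w ∧
      c = (∫ s in Ioi (0 : ℝ), w s ^ 2) ^ ((d : ℝ) / 2) * gDefect d f w}
  have hbdd : BddBelow S := by
    refine ⟨(4 : ℝ) ^ (-((d : ℝ) / 2)) / (2 * d), ?_⟩
    rintro c ⟨f, w, h, rfl⟩
    exact h.le_value hd
  obtain ⟨c, -, hc, hmem⟩ := exists_seq_tendsto_sInf (S := S) ⟨_, f₀, w₀, h₀, rfl⟩ hbdd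
  -- The infimum need not be attained; positivity of 𝓘_d makes the negative power continuous along a
  -- minimizing sequence.
  have hcont : ContinuousAt (kineticConst d) (varI d) :=
    (Real.continuousAt_rpow_const _ _ (.inl (varI_pos hd).ne')).const_mul _
  refine le_of_tendsto' ((hcont.tendsto.comp hc).mul_const _) fun k => ?_
  obtain ⟨f, w, h, hk⟩ := hmem k
  rw [Function.comp_apply, hk]
  exact (h.kinetic_inequality hd hu hortho).2

end Inequality

end MatrixKinetic

theorem mainTheorem2 (d q N : ℕ) (hd : 1 ≤ d) (hq : 1 ≤ q)
    (u : Fin N → MatrixKinetic.L2 d q)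
    (hu : ∀ n, MatrixKinetic.MemH1 (u n)) (hortho : Orthonormal ℂ u) :
    0 < MatrixKinetic.varI d ∧
    MatrixKinetic.Ktilde d =
      (2 : ℝ) ^ (6 / (d : ℝ)) * (d : ℝ) ^ (1 - 2 / (d : ℝ)) /
          ((d : ℝ) + 2) ^ (1 + 4 / (d : ℝ)) *
        MatrixKinetic.varI d ^ (-(2 / (d : ℝ))) * MatrixKinetic.Kcl d ∧
    Integrable (fun x : EuclideanSpace ℝ (Fin d) =>
      MatrixKinetic.tracePow (MatrixKinetic.densityMatrix u x) (1 + 2 / (d : ℝ))) ∧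
    MatrixKinetic.Ktilde d *
        ∫ x : EuclideanSpace ℝ (Fin d),
          MatrixKinetic.tracePow (MatrixKinetic.densityMatrix u x) (1 + 2 / (d : ℝ)) ≤
      ∑ n, MatrixKinetic.gradSqIntegral (hu n) := by
  obtain ⟨f, w, h⟩ := MatrixKinetic.exists_admissible d hd
  exact ⟨MatrixKinetic.varI_pos hd, MatrixKinetic.Ktilde_eq_mul_Kcl hd,
    (h.kinetic_inequality hd hu hortho).1, MatrixKinetic.Ktilde_mul_le hd hu hortho⟩
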